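/- Let $F=\mathbb{Q}(\sqrt{-3})\subset\mathbb{C}$ with ring of integers $\mathcal{O}_F=\mathbb{Z}[\rho]$, $\rho=(-1+\sqrt{-3})/2$, and let $h(z)=z_1\bar z_2+\bar z_1z_2+z_3\bar z_3$ on $\mathbb{C}^3$, a hermitian form of signature $(2,1)$. Let $G^+(\mathbb{R})$ be the group of $g\in \mathrm{GL}(3,\mathbb{C})$ with $h(gz)=\eta\, h(z)$ for all $z$, for some real $\eta=\eta(g)>0$. It acts on the ball $B=\{(u,v)\in\mathbb{C}^2 : v+\bar v+u\bar u<0\}$ by $$g\cdot(u,v)=\left(\frac{g_{31}v+g_{32}+g_{33}u}{g_{21}v+g_{22}+g_{23}u},\ \frac{g_{11}v+g_{12}+g_{13}u}{g_{21}v+g_{22}+g_{23}u}\right).$$ For $g\in G^+(\mathbb{R})$ and $(u,v)\in B$ put $j_1(g,u,v)=g_{21}v+g_{22}+g_{23}u$ and $$j_2(g,u,v)=\det(g)^{-1}\begin{pmatrix}G_{32}u+G_{33}&G_{32}v+G_{31}\\ G_{12}u+G_{13}&G_{12}v+G_{11}\end{pmatrix},$$ where $G_{ij}$ is the minor of $g_{ij}$,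 that is, the (unsigned) determinant of $g$ with row $i$ and column $j$ removed. Let $$\Gamma_1[\sqrt{-3}]=\{g\in \mathrm{GL}(3,\mathcal{O}_F) : h(gz)=h(z)\ \text{for all } z,\ \det g=1,\ g\equiv 1 \bmod \sqrt{-3}\}.$$ For integers $j\ge 0$ and $k$, let $M_{j,k}(\Gamma_1[\sqrt{-3}])$ be the complex vector space of holomorphic maps $f:B\to \mathrm{Sym}^j(\mathbb{C}^2)$ such that $$j_1(g,u,v)^{-k}\,\mathrm{Sym}^j\!\left(j_2(g,u,v)^{-1}\right)f(g\cdot(u,v))=f(u,v)$$ for all $g\in\Gamma_1[\sqrt{-3}]$ and $(u,v)\in B$. Proposition. If $k<0$ and $j\ge 0$, then $M_{j,k}(\Gamma_1[\sqrt{-3}])=0$. -/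

import Mathlib

open Matrix ComplexConjugate

namespace Picard

noncomputable section

/-! ### The hermitian form, the group of similitudes and the ball -/

/-- The hermitian form `h(z₁,z₂,z₃) = z₁ z₂' + z₁' z₂ + z₃ z₃'` on `V ⊗ ℝ = ℂ³`
(of signature `(2,1)`); it takes real values. -/
def hermForm (z : Fin 3 → ℂ) : ℂ :=
  z 0 * conj (z 1) + conj (z 0) * z 1 + z 2 * conj (z 2)

/-- `G⁺(ℝ)`: the similitudes of `h` with positive multiplier `η`. -/
def GUPlus : Subgroup (GL (Fin 3) ℂ) where
  carrier := {g | ∃ η : ℝ, 0 < η ∧ ∀ z : Fin 3 → ℂ, hermForm (g.1 *ᵥ z) = η * hermForm z}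
  one_mem' := ⟨1, one_pos, fun z => by simp⟩
  mul_mem' := by
    rintro a b ⟨η, hη, ha⟩ ⟨θ, hθ, hb⟩
    refine ⟨η * θ, mul_pos hη hθ, fun z => ?_⟩
    rw [Units.val_mul, ← Matrix.mulVec_mulVec, ha, hb]
    push_cast
    ring
  inv_mem' := by
    rintro a ⟨η, hη, ha⟩
    refine ⟨η⁻¹, inv_pos.mpr hη, fun z => ?_⟩
    have hz := ha ((a⁻¹).1 *ᵥ z)
    rw [Matrix.mulVec_mulVec, Units.mul_inv, Matrix.one_mulVec] at hz
    have hη' : (η : ℂ) ≠ 0 := by exact_mod_cast hη.ne'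
    rw [hz]
    push_cast
    field_simp

/-- The unitary group `G⁰(ℝ) = U(2,1)`: multiplier `1`. -/
def U21 : Subgroup GUPlus where
  carrier := {g | ∀ z : Fin 3 → ℂ, hermForm (g.1.1 *ᵥ z) = hermForm z}
  one_mem' := fun z => by simp
  mul_mem' := by
    intro a b ha hb z
    have h1 := ha (b.1.1 *ᵥ z)
    rw [Matrix.mulVec_mulVec] at h1
    exact h1.trans (hb z)
  inv_mem' := by
    intro a ha z
    have hz := ha ((a.1⁻¹).1 *ᵥ z)
    rw [Matrix.mulVec_mulVec, Units.mul_inv, Matrix.one_mulVec] at hz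
    exact hz.symm

/-- The ball `B = {(u,v) ∈ ℂ² : v + v̄ + u ū < 0}`; the point `(u,v)` is the negative line
spanned by `(v,1,u)`. -/
def ball : Set (ℂ × ℂ) := {p | 2 * p.2.re + ‖p.1‖ ^ 2 < 0}

theorem hermForm_lift (p : ℂ × ℂ) :
    hermForm ![p.2, 1, p.1] = ((2 * p.2.re + ‖p.1‖ ^ 2 : ℝ) : ℂ) := by
  have h1 := Complex.mul_conj' p.1
  have h2 := Complex.add_conj p.2
  simp only [hermForm, Matrix.cons_val_zero, Matrix.cons_val_one, Matrix.cons_val, map_one,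
    mul_one]
  rw [h1, h2]
  push_cast
  ring

/-! ### Automorphy factors and the action on the ball -/

/-- The minor `G_{ij}`: the determinant of `g` with row `i` and column `j` removed. -/
def minor (g : Matrix (Fin 3) (Fin 3) ℂ) (i j : Fin 3) : ℂ :=
  (g.submatrix i.succAbove j.succAbove).det

/-- `j₁(g,u,v) = g₂₁ v + g₂₂ + g₂₃ u`. -/
def j₁ (g : Matrix (Fin 3) (Fin 3) ℂ) (p : ℂ × ℂ) : ℂ :=
  g 1 0 * p.2 + g 1 1 + g 1 2 * p.1

/-- `j₂(g,u,v) = det(g)⁻¹ (G₃₂ u + G₃₃, G₃₂ v + G₃₁; G₁₂ u + G₁₃, G₁₂ v + G₁₁)`. -/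
def j₂ (g : Matrix (Fin 3) (Fin 3) ℂ) (p : ℂ × ℂ) : Matrix (Fin 2) (Fin 2) ℂ :=
  g.det⁻¹ •
    !![minor g 2 1 * p.1 + minor g 2 2, minor g 2 1 * p.2 + minor g 2 0;
       minor g 0 1 * p.1 + minor g 0 2, minor g 0 1 * p.2 + minor g 0 0]

/-- The fractional linear action on coordinates `(u,v)`. -/
def actCoord (g : Matrix (Fin 3) (Fin 3) ℂ) (p : ℂ × ℂ) : ℂ × ℂ :=
  ((g 2 0 * p.2 + g 2 1 + g 2 2 * p.1) / j₁ g p,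
   (g 0 0 * p.2 + g 0 1 + g 0 2 * p.1) / j₁ g p)

theorem mulVec_lift (g : Matrix (Fin 3) (Fin 3) ℂ) (p : ℂ × ℂ) :
    g *ᵥ ![p.2, 1, p.1] =
      ![g 0 0 * p.2 + g 0 1 + g 0 2 * p.1, j₁ g p, g 2 0 * p.2 + g 2 1 + g 2 2 * p.1] := by
  ext i
  fin_cases i <;> simp [Matrix.mulVec, dotProduct, Fin.sum_univ_three, j₁]

theorem j₁_ne_zero (g : GUPlus) (p : ball) : j₁ g.1.1 p.1 ≠ 0 := by
  obtain ⟨η, hη, hg⟩ := g.2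
  intro h0
  have h := hg ![p.1.2, 1, p.1.1]
  rw [mulVec_lift, hermForm_lift, h0] at h
  simp only [hermForm, Matrix.cons_val_zero, Matrix.cons_val_one, Matrix.cons_val, map_zero,
    mul_zero, zero_add] at h
  rw [Complex.mul_conj'] at h
  have h' : ‖g.1.1 2 0 * p.1.2 + g.1.1 2 1 + g.1.1 2 2 * p.1.1‖ ^ 2
      = η * (2 * p.1.2.re + ‖p.1.1‖ ^ 2) := by exact_mod_cast h
  have hp : 2 * p.1.2.re + ‖p.1.1‖ ^ 2 < 0 := p.2
  have := mul_neg_of_pos_of_neg hη hp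
  nlinarith [sq_nonneg ‖g.1.1 2 0 * p.1.2 + g.1.1 2 1 + g.1.1 2 2 * p.1.1‖]

theorem actCoord_mem (g : GUPlus) (p : ball) : actCoord g.1.1 p.1 ∈ ball := by
  have h0 := j₁_ne_zero g p
  obtain ⟨η, hη, hg⟩ := g.2
  have h := hg ![p.1.2, 1, p.1.1]
  rw [mulVec_lift, hermForm_lift] at h
  have h2 := hermForm_lift (actCoord g.1.1 p.1)
  have hp : 2 * p.1.2.re + ‖p.1.1‖ ^ 2 < 0 := p.2
  have key : ((2 * (actCoord g.1.1 p.1).2.re + ‖(actCoord g.1.1 p.1).1‖ ^ 2 : ℝ) : ℂ)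
      = ((η * (2 * p.1.2.re + ‖p.1.1‖ ^ 2) / ‖j₁ g.1.1 p.1‖ ^ 2 : ℝ) : ℂ) := by
    rw [← h2]
    push_cast at h ⊢
    rw [← h, ← Complex.mul_conj']
    have hc : conj (j₁ g.1.1 p.1) ≠ 0 := by simpa using h0
    simp only [hermForm, actCoord, Matrix.cons_val_zero, Matrix.cons_val_one, Matrix.cons_val,
      map_one, mul_one, map_div₀]
    field_simp
  have key' := Complex.ofReal_injective key
  change _ < (0 : ℝ)
  rw [key']
  exact div_neg_of_neg_of_pos (mul_neg_of_pos_of_neg hη hp)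
    (pow_pos (norm_pos_iff.mpr h0) 2)

/-- The action of `g ∈ G⁺(ℝ)` on the ball `B`. -/
def act (g : GUPlus) (p : ball) : ball := ⟨actCoord g.1.1 p.1, actCoord_mem g p⟩

/-- `det j₂ = j₁ · det(g)⁻¹`; in particular `j₂(g,u,v)` is invertible. -/
theorem det_j₂ (g : GL (Fin 3) ℂ) (p : ℂ × ℂ) :
    (j₂ g.1 p).det = j₁ g.1 p * (g.1.det)⁻¹ := by
  have h : g.1.det ≠ 0 := ((Matrix.isUnit_iff_isUnit_det _).mp g.isUnit).ne_zero
  have e : ∀ a b c d : ℂ, (g.1.det⁻¹ • !![a, b; c, d]).det = (g.1.det⁻¹) ^ 2 * (a * d - b * c) := by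
    intro a b c d
    simp [Matrix.det_fin_two]
    ring
  rw [j₂, e]
  field_simp
  simp [minor, j₁, Matrix.det_fin_two, Matrix.det_fin_three, Fin.succAbove, Fin.lt_def]
  ring

/-! ### Symmetric powers of `ℂ²` -/

/-- `Sym^j(ℂ²)`, realised as the degree `j` part of `Sym(ℂ²) = ℂ[X₀,X₁]`, where `X₀, X₁` is the
standard basis of `ℂ²`. -/
abbrev SymPow (j : ℕ) : Type := MvPolynomial.homogeneousSubmodule (Fin 2) ℂ j

/-- The algebra endomorphism of `Sym(ℂ²) = ℂ[X₀,X₁]` induced by a `2 × 2` matrix `A` acting on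
`ℂ²`: the basis vector `Xᵢ` goes to the `i`-th column `∑ₗ A_{li} Xₗ`. -/
def symAlg (A : Matrix (Fin 2) (Fin 2) ℂ) :
    MvPolynomial (Fin 2) ℂ →ₐ[ℂ] MvPolynomial (Fin 2) ℂ :=
  MvPolynomial.aeval fun i => ∑ l, MvPolynomial.C (A l i) * MvPolynomial.X l

theorem symAlg_isHomogeneous (A : Matrix (Fin 2) (Fin 2) ℂ) {j : ℕ} {P : MvPolynomial (Fin 2) ℂ}
    (hP : P.IsHomogeneous j) : (symAlg A P).IsHomogeneous j := by
  have := hP.aeval (fun i => ∑ l, MvPolynomial.C (A l i) * MvPolynomial.X l) (n := 1)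
    (fun i => MvPolynomial.IsHomogeneous.sum _ _ _ fun l _ => by
      simpa using (MvPolynomial.isHomogeneous_C (Fin 2) (A l i)).mul
        (MvPolynomial.isHomogeneous_X ℂ l))
  simpa [symAlg] using this

/-- `Sym^j(A)` acting on `Sym^j(ℂ²)`. -/
def symPow (j : ℕ) (A : Matrix (Fin 2) (Fin 2) ℂ) : SymPow j →ₗ[ℂ] SymPow j :=
  (symAlg A).toLinearMap.restrict fun P hP =>
    (MvPolynomial.mem_homogeneousSubmodule j _).mpr
      (symAlg_isHomogeneous A ((MvPolynomial.mem_homogeneousSubmodule j P).mp hP))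

theorem coe_symPow (j : ℕ) (A : Matrix (Fin 2) (Fin 2) ℂ) (P : SymPow j) :
    (symPow j A P : MvPolynomial (Fin 2) ℂ) = symAlg A P := rfl

/-! ### Modular forms -/

/-- The slash operator
`(f |_{j,k} g)(u,v) = j₁(g,u,v)^{-k} Sym^j(j₂(g,u,v)⁻¹) f(g·(u,v))`. -/
def slash (j : ℕ) (k : ℤ) (g : GUPlus) : (ball → SymPow j) →ₗ[ℂ] (ball → SymPow j) where
  toFun f p := j₁ g.1.1 p.1 ^ (-k) • symPow j (j₂ g.1.1 p.1)⁻¹ (f (act g p))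
  map_add' f f' := by
    ext1 p
    simp
  map_smul' c f := by
    ext1 p
    simp only [Pi.smul_apply, map_smul, RingHom.id_apply]
    rw [smul_comm]

/-- A map from `B` to a (finite-dimensional) complex vector space is holomorphic if its
composition with every linear functional is complex differentiable on `B`. -/
def IsHolomorphic {W : Type*} [AddCommGroup W] [Module ℂ W] (f : ball → W) : Prop :=
  ∀ φ : Module.Dual ℂ W,
    DifferentiableOn ℂ (Function.extend Subtype.val (fun p => φ (f p)) 0) ball

/-- `M_{j,k}(Γ_*)`: holomorphic `f : B → Sym^j(ℂ²)` with `f |_{j,k} g = f` for all `g ∈ Γ_*`. -/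
def modularForms (j : ℕ) (k : ℤ) (Γs : Subgroup GUPlus) : Submodule ℂ (ball → SymPow j) where
  carrier := {f | IsHolomorphic f ∧ ∀ g ∈ Γs, slash j k g f = f}
  zero_mem' := by
    refine ⟨fun φ => ?_, fun g _ => map_zero _⟩
    have : (Function.extend Subtype.val (fun p : ball => φ ((0 : ball → SymPow j) p)) 0
        : ℂ × ℂ → ℂ) = fun _ => 0 := by
      funext x
      by_cases hx : x ∈ ball
      · have h := Subtype.val_injective.extend_apply
          (fun p : ball => φ ((0 : ball → SymPow j) p)) (0 : ℂ × ℂ → ℂ) ⟨x, hx⟩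
        simpa using h
      · rw [Function.extend_apply' _ _ _ (by rintro ⟨a, rfl⟩; exact hx a.2)]
        rfl
    rw [this]
    exact differentiableOn_const 0
  add_mem' := by
    rintro f f' ⟨hf, hf1⟩ ⟨hf', hf1'⟩
    refine ⟨fun φ => ?_, fun g hg => by rw [map_add, hf1 g hg, hf1' g hg]⟩
    refine ((hf φ).add (hf' φ)).congr fun x hx => ?_
    have e := fun F : ball → ℂ => Subtype.val_injective.extend_apply F (0 : ℂ × ℂ → ℂ) ⟨x, hx⟩
    simp only at e
    simp only [Pi.add_apply, e, map_add]
  smul_mem' := by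
    rintro c f ⟨hf, hf1⟩
    refine ⟨fun φ => ?_, fun g hg => by rw [map_smul, hf1 g hg]⟩
    refine ((hf φ).const_smul c).congr fun x hx => ?_
    have e := fun F : ball → ℂ => Subtype.val_injective.extend_apply F (0 : ℂ × ℂ → ℂ) ⟨x, hx⟩
    simp only at e
    simp only [Pi.smul_apply, e, map_smul]

/-! ### The Eisenstein integers and the Picard modular groups -/

/-- `√-3 = i √3`. -/
def sqrtNeg3 : ℂ := Complex.I * (Real.sqrt 3 : ℂ)

/-- The primitive third root of unity `ρ = (-1 + √-3)/2`. -/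
def rho : ℂ := (-1 + sqrtNeg3) / 2

/-- The ring of integers `𝓞_F = ℤ[ρ]` of `F = ℚ(√-3) ⊆ ℂ`; the Galois automorphism of `F` is
complex conjugation. -/
abbrev OF : Subalgebra ℤ ℂ := Algebra.adjoin ℤ {rho}

theorem sqrtNeg3_mem : sqrtNeg3 ∈ OF := by
  have h : sqrtNeg3 = 2 * rho + 1 := by
    rw [rho]
    ring
  rw [h]
  exact add_mem (mul_mem (ofNat_mem _ 2) (Algebra.subset_adjoin rfl)) (one_mem _)

/-- The ideal `(√-3)` of `𝓞_F`. -/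
def idealSqrtNeg3 : Ideal OF := Ideal.span {⟨sqrtNeg3, sqrtNeg3_mem⟩}

/-- `GL(3,𝓞_F)` as a subgroup of `GL(3,ℂ)`. -/
def GL3OF : Subgroup (GL (Fin 3) ℂ) :=
  (Matrix.GeneralLinearGroup.map (n := Fin 3) (algebraMap OF ℂ)).range

/-- `{g ∈ GL(3,𝓞_F) : g ≡ 1 mod √-3}` as a subgroup of `GL(3,ℂ)`. -/
def GL3OFCong : Subgroup (GL (Fin 3) ℂ) :=
  (Matrix.GeneralLinearGroup.map (n := Fin 3) (Ideal.Quotient.mk idealSqrtNeg3)).ker.map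
    (Matrix.GeneralLinearGroup.map (n := Fin 3) (algebraMap OF ℂ))

/-- The Picard modular group `Γ = G⁰(ℤ) = {g ∈ GL(3,𝓞_F) : h(gz) = h(z)}`. -/
def Gam : Subgroup GUPlus := GL3OF.comap GUPlus.subtype ⊓ U21

/-- `Γ₁ = Γ ∩ ker det`. -/
def Gam1 : Subgroup GUPlus :=
  Gam ⊓ (Matrix.GeneralLinearGroup.det.comp GUPlus.subtype).ker

/-- `Γ₁[√-3] = {g ∈ Γ₁ : g ≡ 1 mod √-3}`. -/
def Gam1SqrtNeg3 : Subgroup GUPlus := Gam1 ⊓ GL3OFCong.comap GUPlus.subtype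

end

end Picard

/-!
The value of a modular form at `p ∈ B` is a binary form on the plane `ℂ³ / L`, where `L` is the
negative line of `p`: the factor `j₂` is the action on linear forms that vanish on `L`. A modular
form of weight `(j,k)` therefore becomes a `Γ₁[√-3]`-invariant function `Φ(X, q)` (`homogForm`) of a
negative vector `X` and a vector `q`, homogeneous of degree `-k` in `X` (`homogForm_mulVec`).

Fix `q = n` with Eisenstein integral coordinates and `c = h(n) > 0`, and let `X` run through the
negative vectors of the plane `n^⊥`, of signature `(1,1)`. The stabiliser of `n` contains the
elements of norm one and congruent to `1` modulo some `N` in an order of the quaternion algebra over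
`ℚ` with norm form `|α|² - c|β|²`, `α, β ∈ ℚ(√-3)`. If `c ≡ 2 mod 4`, then `c` is not a norm from
`ℚ(√-3)`, since `2` is inert, and the quaternion algebra is a division algebra. Its unit group acts
cocompactly on `n^⊥` (`exists_unit_translate_bounded_uniform`): Dirichlet approximation gives
elements of bounded norm that move a given point to a bounded set, and by the pigeonhole principle
these fall into finitely many classes modulo units. Hence `|Φ(X, n)|` attains a maximum on the
hyperboloid `h(X) = const`. On the disc through the maximum, the condition `-k > 0` contradicts the
maximum principle unless the maximum is zero (`eq_zero_of_homogeneous_of_translate`). So `Φ(X, n)`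
vanishes for all negative `X ∈ n^⊥` (`homogForm_eq_zero_of_orthogonal`); no cusps are involved.

The vectors `n` with these properties are dense in enough directions for continuity to give, at
every `p ∈ B`, the vanishing of the binary form at infinitely many points of a line that avoids the
origin (`eval_eq_zero_of_odd`). A binary form with this property is zero.
-/

namespace Picard

/-! ### The Eisenstein integers -/

theorem rho_re : rho.re = -1 / 2 := by
  simp [rho, sqrtNeg3]

theorem rho_im : rho.im = Real.sqrt 3 / 2 := by
  simp [rho, sqrtNeg3]

theorem rho_sq : rho ^ 2 = -1 - rho := by
  have h : (Real.sqrt 3 : ℂ) ^ 2 = 3 := by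
    exact_mod_cast Real.sq_sqrt (by norm_num : (0 : ℝ) ≤ 3)
  rw [rho, sqrtNeg3]
  linear_combination (Complex.I ^ 2 / 4) * h + (3 / 4) * Complex.I_sq

theorem conj_rho : conj rho = -1 - rho := by
  apply Complex.ext
  · simp [rho_re]; norm_num
  · simp

theorem mem_OF_iff {z : ℂ} : z ∈ OF ↔ ∃ a b : ℤ, z = a + b * rho := by
  constructor
  · intro hz
    induction hz using Algebra.adjoin_induction with
    | mem x hx =>
      rw [Set.mem_singleton_iff] at hx
      exact ⟨0, 1, by simp [hx]⟩
    | algebraMap r => exact ⟨r, 0, by simp⟩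
    | add x y _ _ hx hy =>
      obtain ⟨a, b, rfl⟩ := hx
      obtain ⟨d, e, rfl⟩ := hy
      exact ⟨a + d, b + e, by push_cast; ring⟩
    | mul x y _ _ hx hy =>
      obtain ⟨a, b, rfl⟩ := hx
      obtain ⟨d, e, rfl⟩ := hy
      refine ⟨a * d - b * e, a * e + b * d - b * e, ?_⟩
      push_cast
      linear_combination (b * e : ℂ) * rho_sq
  · rintro ⟨a, b, rfl⟩
    exact add_mem (intCast_mem _ a)
      (mul_mem (intCast_mem _ b) (Algebra.subset_adjoin rfl))

theorem conj_mem_OF {z : ℂ} (hz : z ∈ OF) : conj z ∈ OF := by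
  obtain ⟨a, b, rfl⟩ := mem_OF_iff.mp hz
  refine mem_OF_iff.mpr ⟨a - b, -b, ?_⟩
  simp only [map_add, map_mul, map_intCast, conj_rho]
  push_cast
  ring

theorem norm_sq_add_mul_rho (a b : ℝ) : ‖(a + b * rho : ℂ)‖ ^ 2 = a ^ 2 - a * b + b ^ 2 := by
  have h3 := Real.sq_sqrt (by norm_num : (0 : ℝ) ≤ 3)
  rw [Complex.sq_norm, Complex.normSq_apply]
  simp only [Complex.add_re, Complex.add_im, Complex.mul_re, Complex.mul_im, Complex.ofReal_re,
    Complex.ofReal_im, rho_re, rho_im]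
  linear_combination (b ^ 2 / 4) * h3

theorem norm_add_mul_rho_le (a b : ℝ) : ‖(a + b * rho : ℂ)‖ ≤ |a| + |b| := by
  refine abs_le_of_sq_le_sq' ?_ (by positivity) |>.2
  rw [norm_sq_add_mul_rho, add_sq, sq_abs, sq_abs]
  nlinarith [neg_abs_le (a * b), abs_mul a b, abs_nonneg (a * b)]

theorem exists_eq_add_mul_rho (z : ℂ) : ∃ a b : ℝ, z = a + b * rho := by
  have h3 : Real.sqrt 3 ≠ 0 := by positivity
  refine ⟨z.re + z.im / Real.sqrt 3, 2 * z.im / Real.sqrt 3, ?_⟩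
  apply Complex.ext
  · simp [rho_re]
    field_simp
    ring
  · simp [rho_im]
    field_simp

theorem exists_mem_OF_norm_sub_le (z : ℂ) : ∃ w ∈ OF, ‖z - w‖ ≤ 1 := by
  obtain ⟨a, b, rfl⟩ := exists_eq_add_mul_rho z
  refine ⟨round a + round b * rho, mem_OF_iff.mpr ⟨_, _, rfl⟩, ?_⟩
  have h := norm_add_mul_rho_le (a - round a) (b - round b)
  have ha := abs_sub_round a
  have hb := abs_sub_round b
  push_cast at h
  calc _ = ‖(a - round a : ℂ) + (b - round b) * rho‖ := by congr 1; ring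
    _ ≤ 1 := by linarith

/-- The prime `2` is inert in `ℤ[ρ]`. -/
theorem even_of_even_norm {a b : ℤ} (h : 2 ∣ a ^ 2 - a * b + b ^ 2) : 2 ∣ a ∧ 2 ∣ b := by
  rcases Int.even_or_odd' a with ⟨a', rfl | rfl⟩ <;> rcases Int.even_or_odd' b with ⟨b', rfl | rfl⟩
  · omega
  all_goals
    exfalso
    ring_nf at h
    obtain ⟨d, hd⟩ := h
    have := congrArg (· % 2) hd
    ring_nf at this
    omega

/-- An integer `c ≡ 2 mod 4` has odd `2`-adic valuation, so it is no quotient of two norms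
from `ℤ[ρ]`. -/
theorem eq_zero_of_norm_eq_mul_norm {c : ℤ} (hc : c % 4 = 2) (a b d e : ℤ)
    (h : a ^ 2 - a * b + b ^ 2 = c * (d ^ 2 - d * e + e ^ 2)) :
    a = 0 ∧ b = 0 ∧ d = 0 ∧ e = 0 := by
  obtain ⟨m, hm⟩ : ∃ m, m = a.natAbs + b.natAbs + d.natAbs + e.natAbs := ⟨_, rfl⟩
  induction m using Nat.strong_induction_on generalizing a b d e with
  | _ m ih =>
    obtain ⟨c', rfl⟩ : ∃ c', c = 4 * c' + 2 := ⟨c / 4, by omega⟩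
    obtain ⟨⟨a', rfl⟩, ⟨b', rfl⟩⟩ := even_of_even_norm (a := a) (b := b)
      ⟨(2 * c' + 1) * (d ^ 2 - d * e + e ^ 2), by rw [h]; ring⟩
    obtain ⟨⟨d', rfl⟩, ⟨e', rfl⟩⟩ := even_of_even_norm (a := d) (b := e)
      ⟨a' ^ 2 - a' * b' + b' ^ 2 - c' * (d ^ 2 - d * e + e ^ 2), by linarith⟩
    have h' : a' ^ 2 - a' * b' + b' ^ 2 = (4 * c' + 2) * (d' ^ 2 - d' * e' + e' ^ 2) := by
      linarith
    by_cases h0 : m = 0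
    · omega
    · have := ih (a'.natAbs + b'.natAbs + d'.natAbs + e'.natAbs) (by omega) a' b' d' e' h' rfl
      omega

/-- The norm form `|α|² - c|β|²` of the quaternion algebra is anisotropic and integral on pairs of
Eisenstein integers. -/
theorem exists_int_norm_sub {c : ℤ} (hc : c % 4 = 2) {α β : ℂ} (hα : α ∈ OF) (hβ : β ∈ OF) :
    ∃ n : ℤ, (n : ℝ) = ‖α‖ ^ 2 - c * ‖β‖ ^ 2 ∧ (n = 0 → α = 0 ∧ β = 0) := by
  obtain ⟨a, b, rfl⟩ := mem_OF_iff.mp hα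
  obtain ⟨d, e, rfl⟩ := mem_OF_iff.mp hβ
  refine ⟨a ^ 2 - a * b + b ^ 2 - c * (d ^ 2 - d * e + e ^ 2), ?_, fun h => ?_⟩
  · have h1 := norm_sq_add_mul_rho a b
    have h2 := norm_sq_add_mul_rho d e
    push_cast at h1 h2 ⊢
    rw [h1, h2]
  · obtain ⟨rfl, rfl, rfl, rfl⟩ := eq_zero_of_norm_eq_mul_norm hc a b d e (by linarith)
    simp

/-- Dirichlet's approximation theorem over `ℤ[ρ]`. -/
theorem exists_norm_mul_add_le (z : ℂ) {Q : ℕ} (hQ : 0 < Q) :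
    ∃ α ∈ OF, ∃ β ∈ OF, α ≠ 0 ∧ ‖α‖ ≤ 2 * Q ∧ ‖α * z + β‖ ≤ 2 / Q := by
  classical
  have hQ' : (0 : ℝ) < Q := by exact_mod_cast hQ
  choose A B hAB using exists_eq_add_mul_rho
  let w : ℕ × ℕ → ℂ := fun x => (x.1 + x.2 * rho) * z
  let F : ℕ × ℕ → ℕ × ℕ := fun x => (⌊Int.fract (A (w x)) * Q⌋₊, ⌊Int.fract (B (w x)) * Q⌋₊)
  have hfl : ∀ r : ℝ, ⌊Int.fract r * Q⌋₊ < Q := fun r => by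
    rw [Nat.floor_lt (by have := Int.fract_nonneg r; positivity)]
    nlinarith [Int.fract_lt_one r]
  have hmaps : Set.MapsTo F ↑(Finset.range (Q + 1) ×ˢ Finset.range (Q + 1))
      ↑(Finset.range Q ×ˢ Finset.range Q) := by
    intro x _
    simp only [Finset.coe_product, Finset.coe_range, Set.mem_prod, Set.mem_Iio]
    exact ⟨hfl _, hfl _⟩
  have hcard : (Finset.range Q ×ˢ Finset.range Q).card
      < (Finset.range (Q + 1) ×ˢ Finset.range (Q + 1)).card := by
    simp only [Finset.card_product, Finset.card_range]
    nlinarith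
  obtain ⟨x, hx, y, hy, hxy, hF⟩ := Finset.exists_ne_map_eq_of_card_lt_of_maps_to hcard hmaps
  have hclose : ∀ r s : ℝ, ⌊Int.fract r * Q⌋₊ = ⌊Int.fract s * Q⌋₊ →
      |Int.fract r - Int.fract s| ≤ 1 / Q := fun r s h => by
    have h1 := Nat.floor_le (a := Int.fract r * Q) (by have := Int.fract_nonneg r; positivity)
    have h2 := Nat.floor_le (a := Int.fract s * Q) (by have := Int.fract_nonneg s; positivity)
    have h3 := Nat.lt_floor_add_one (Int.fract r * Q)
    have h4 := Nat.lt_floor_add_one (Int.fract s * Q)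
    rw [h] at h1 h3
    rw [le_div_iff₀ hQ', ← abs_of_pos hQ', ← abs_mul, abs_le]
    constructor <;> nlinarith
  simp only [F, Prod.mk.injEq] at hF
  simp only [Finset.mem_product, Finset.mem_range] at hx hy
  refine ⟨((x.1 - y.1 : ℤ) : ℂ) + ((x.2 - y.2 : ℤ) : ℂ) * rho, mem_OF_iff.mpr ⟨_, _, rfl⟩,
    ((⌊A (w y)⌋ - ⌊A (w x)⌋ : ℤ) : ℂ) + ((⌊B (w y)⌋ - ⌊B (w x)⌋ : ℤ) : ℂ) * rho,
    mem_OF_iff.mpr ⟨_, _, rfl⟩, ?_, ?_, ?_⟩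
  · intro h0
    have h := norm_sq_add_mul_rho ((x.1 - y.1 : ℤ) : ℝ) ((x.2 - y.2 : ℤ) : ℝ)
    rw [Complex.ofReal_intCast, Complex.ofReal_intCast, h0] at h
    have h' : (0 : ℤ) = (x.1 - y.1 : ℤ) ^ 2 - (x.1 - y.1 : ℤ) * (x.2 - y.2 : ℤ)
        + (x.2 - y.2 : ℤ) ^ 2 := by
      have h'' : (0 : ℝ) = ((x.1 - y.1 : ℤ) : ℝ) ^ 2 - ((x.1 - y.1 : ℤ) : ℝ) *
        ((x.2 - y.2 : ℤ) : ℝ) + ((x.2 - y.2 : ℤ) : ℝ) ^ 2 := by simpa using h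
      exact_mod_cast h''
    have := eq_zero_of_norm_eq_mul_norm (c := 2) (by norm_num) (x.1 - y.1 : ℤ) (x.2 - y.2) 0 0
      (by linarith)
    exact hxy (Prod.ext (by omega) (by omega))
  · have h := norm_add_mul_rho_le ((x.1 - y.1 : ℤ) : ℝ) ((x.2 - y.2 : ℤ) : ℝ)
    rw [Complex.ofReal_intCast, Complex.ofReal_intCast] at h
    have h1 : |(x.1 - y.1 : ℤ)| ≤ Q := by rw [abs_le]; omega
    have h2 : |(x.2 - y.2 : ℤ)| ≤ Q := by rw [abs_le]; omega
    have h1' : |((x.1 - y.1 : ℤ) : ℝ)| ≤ Q := by exact_mod_cast h1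
    have h2' : |((x.2 - y.2 : ℤ) : ℝ)| ≤ Q := by exact_mod_cast h2
    linarith
  · have h := norm_add_mul_rho_le (Int.fract (A (w x)) - Int.fract (A (w y)))
      (Int.fract (B (w x)) - Int.fract (B (w y)))
    have e : w x - w y = (((x.1 - y.1 : ℤ) : ℂ) + ((x.2 - y.2 : ℤ) : ℂ) * rho) * z := by
      simp only [w]; push_cast; ring
    rw [← e]
    have hx := hAB (w x)
    have hy := hAB (w y)
    rw [← Int.self_sub_floor, ← Int.self_sub_floor, ← Int.self_sub_floor,
      ← Int.self_sub_floor] at h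
    have hA := hclose _ _ hF.1
    have hB := hclose _ _ hF.2
    rw [← Int.self_sub_floor, ← Int.self_sub_floor] at hA hB
    calc _ = _ := by
          congr 1
          nth_rewrite 1 [hx, hy]
          push_cast
          ring
      _ ≤ _ := h
      _ ≤ 2 / Q := by
        have : (2 : ℝ) / Q = 1 / Q + 1 / Q := by ring
        linarith

/-! ### Cocompactness of the unit groups of the quaternion orders -/

/-- Multiplicativity of the quaternion norm form `|s|² - c|t|²`. The pair `(α, β)` stands for the
quaternion that acts on `ℂ²` by `(s, t) ↦ (ᾱ s + c β̄ t, β s + α t)`. -/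
theorem norm_form_mul (c : ℤ) (α β s t : ℂ) :
    ‖conj α * s + c * conj β * t‖ ^ 2 - c * ‖β * s + α * t‖ ^ 2
      = (‖α‖ ^ 2 - c * ‖β‖ ^ 2) * (‖s‖ ^ 2 - c * ‖t‖ ^ 2) := by
  apply Complex.ofReal_injective
  push_cast
  simp only [← Complex.mul_conj', map_add, map_mul, Complex.conj_conj, map_intCast]
  ring

/-- Every point of the hyperboloid is moved to a bounded set by some nonzero pair of Eisenstein
integers: choose it by Dirichlet approximation of `t / s` with denominators up to `‖s‖`. -/
theorem exists_OF_translate_bounded {c : ℤ} (hc0 : 0 < c) {s t : ℂ}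
    (h : ‖s‖ ^ 2 - c * ‖t‖ ^ 2 = 1) :
    ∃ α ∈ OF, ∃ β ∈ OF, α ≠ 0 ∧ ‖conj α * s + c * conj β * t‖ ≤ 4 + 2 * c ∧
      ‖β * s + α * t‖ ≤ 4 + 2 * c := by
  have hc1 : (1 : ℝ) ≤ c := by exact_mod_cast hc0
  have hs1 : 1 ≤ ‖s‖ := by nlinarith [norm_nonneg s, norm_nonneg t, sq_nonneg ‖t‖]
  have hts : ‖t‖ ≤ ‖s‖ := by
    refine abs_le_of_sq_le_sq' ?_ (norm_nonneg s) |>.2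
    nlinarith [sq_nonneg ‖t‖]
  have hs0 : s ≠ 0 := by rintro rfl; norm_num at hs1
  have hs' : (conj s : ℂ) ≠ 0 := by simpa using hs0
  have hQ0 : 0 < ⌈‖s‖⌉₊ := Nat.ceil_pos.mpr (by linarith)
  have hQ1 := Nat.le_ceil ‖s‖
  have hQ2 := (Nat.ceil_lt_add_one (norm_nonneg s)).le
  have hQ3 : (0 : ℝ) < ⌈‖s‖⌉₊ := by exact_mod_cast hQ0
  obtain ⟨α, hα, β, hβ, hα0, h1, h2⟩ := exists_norm_mul_add_le (t / s) hQ0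
  have h2' : ‖α * (t / s) + β‖ ≤ 2 / ‖s‖ := h2.trans (by gcongr)
  have h3 : ‖α * (t / s) + β‖ * ‖s‖ ≤ 2 := by rwa [le_div_iff₀ (by linarith)] at h2'
  refine ⟨α, hα, β, hβ, hα0, ?_, ?_⟩
  · have hC : (s * conj s - c * (t * conj t) : ℂ) = 1 := by
      rw [Complex.mul_conj', Complex.mul_conj']
      exact_mod_cast h
    have e : conj α * s + c * conj β * t
        = conj α / conj s + c * conj (α * (t / s) + β) * t := by
      simp only [map_add, map_mul, map_div₀]
      field_simp
      linear_combination (conj α) * hC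
    rw [e]
    refine (norm_add_le _ _).trans (add_le_add ?_ ?_)
    · rw [norm_div, Complex.norm_conj, Complex.norm_conj, div_le_iff₀ (by linarith)]
      linarith
    · rw [norm_mul, norm_mul, Complex.norm_conj, Complex.norm_intCast,
        abs_of_pos (by exact_mod_cast hc0)]
      have : ‖α * (t / s) + β‖ * ‖t‖ ≤ 2 := le_trans (by gcongr) h3
      nlinarith
  · have e : β * s + α * t = (α * (t / s) + β) * s := by field_simp; ring
    rw [e, norm_mul]
    linarith

/-- Two elements `x = y + n r N z` and `y` of equal norm `n` in the order differ by the element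
`y⁻¹ x = 1 + r N ȳ z` of norm one, so a point that `x` moves to a bounded set is moved by this
element to a set bounded in terms of `y`. -/
theorem exists_unit_translate_bounded {c n r : ℤ} {N : ℕ} {D : ℝ} (hc0 : 0 < c) (hn : n ≠ 0)
    {x₁ x₂ y₁ y₂ z₁ z₂ s t : ℂ} (hy₁ : y₁ ∈ OF) (hy₂ : y₂ ∈ OF) (hz₁ : z₁ ∈ OF) (hz₂ : z₂ ∈ OF)
    (hx₁ : x₁ = y₁ + n * r * N * z₁) (hx₂ : x₂ = y₂ + n * r * N * z₂)
    (hx : ‖x₁‖ ^ 2 - c * ‖x₂‖ ^ 2 = n) (hy : ‖y₁‖ ^ 2 - c * ‖y₂‖ ^ 2 = n)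
    (h1 : ‖conj x₁ * s + c * conj x₂ * t‖ ≤ D) (h2 : ‖x₂ * s + x₁ * t‖ ≤ D) :
    ∃ α ∈ OF, ∃ β ∈ OF, ‖1 + N * α‖ ^ 2 - c * ‖N * β‖ ^ 2 = 1 ∧
      ‖conj (1 + N * α) * s + c * conj (N * β) * t‖ ≤ (‖y₁‖ + c * ‖y₂‖) * D ∧
      ‖N * β * s + (1 + N * α) * t‖ ≤ (‖y₁‖ + c * ‖y₂‖) * D := by
  have hnR : (n : ℝ) ≠ 0 := by exact_mod_cast hn
  have hnC : (n : ℂ) ≠ 0 := by exact_mod_cast hn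
  have hc1 : (1 : ℝ) ≤ c := by exact_mod_cast hc0
  have hn1 : (1 : ℝ) ≤ ‖(n : ℂ)‖ := by
    rw [Complex.norm_intCast]
    exact_mod_cast Int.one_le_abs hn
  have hyC : (y₁ * conj y₁ - c * (y₂ * conj y₂) : ℂ) = n := by
    rw [Complex.mul_conj', Complex.mul_conj']
    exact_mod_cast hy
  have hint : ∀ m : ℤ, (m : ℂ) ∈ OF := fun m => intCast_mem _ m
  have hα : (n : ℂ) * (1 + N * (r * (conj y₁ * z₁ - c * y₂ * conj z₂)))
      = conj y₁ * x₁ - c * y₂ * conj x₂ := by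
    rw [hx₁, hx₂]
    simp only [map_add, map_mul, map_intCast, map_natCast]
    linear_combination -hyC
  have hβ : (n : ℂ) * (N * (r * (conj y₁ * z₂ - y₂ * conj z₁)))
      = conj y₁ * x₂ - y₂ * conj x₁ := by
    rw [hx₁, hx₂]
    simp only [map_add, map_mul, map_intCast, map_natCast]
    ring
  refine ⟨r * (conj y₁ * z₁ - c * y₂ * conj z₂),
    mul_mem (hint r) (sub_mem (mul_mem (conj_mem_OF hy₁) hz₁)
      (mul_mem (mul_mem (hint c) hy₂) (conj_mem_OF hz₂))),
    r * (conj y₁ * z₂ - y₂ * conj z₁),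
    mul_mem (hint r) (sub_mem (mul_mem (conj_mem_OF hy₁) hz₂)
      (mul_mem hy₂ (conj_mem_OF hz₁))), ?_, ?_, ?_⟩
  all_goals
    generalize (1 + N * (r * (conj y₁ * z₁ - c * y₂ * conj z₂)) : ℂ) = α at hα ⊢
    generalize (N * (r * (conj y₁ * z₂ - y₂ * conj z₁)) : ℂ) = β at hβ ⊢
  · have h := norm_form_mul c (conj y₁) (-y₂) (conj x₁) x₂
    have e1 : conj (conj y₁) * conj x₁ + c * conj (-y₂) * x₂ = conj ((n : ℂ) * α) := by
      rw [hα]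
      simp only [map_sub, map_mul, map_neg, map_intCast, Complex.conj_conj]
      ring
    have e2 : -y₂ * conj x₁ + conj y₁ * x₂ = (n : ℂ) * β := by
      rw [hβ]
      ring
    rw [e1, e2, Complex.norm_conj, Complex.norm_conj, Complex.norm_conj, norm_neg, norm_mul,
      norm_mul, hx, hy, Complex.norm_intCast, mul_pow, mul_pow, sq_abs] at h
    have h' : (n : ℝ) ^ 2 * (‖α‖ ^ 2 - c * ‖β‖ ^ 2) = n ^ 2 * 1 := by linarith
    exact mul_left_cancel₀ (pow_ne_zero 2 hnR) h'
  · have e : (n : ℂ) * (conj α * s + c * conj β * t)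
        = y₁ * (conj x₁ * s + c * conj x₂ * t) - c * conj y₂ * (x₂ * s + x₁ * t) := by
      have hα' := congrArg conj hα
      have hβ' := congrArg conj hβ
      simp only [map_sub, map_mul, map_intCast, Complex.conj_conj] at hα' hβ'
      linear_combination s * hα' + c * t * hβ'
    calc _ ≤ ‖(n : ℂ)‖ * ‖conj α * s + c * conj β * t‖ :=
          le_mul_of_one_le_left (norm_nonneg _) hn1
      _ = _ := by rw [← norm_mul, e]
      _ ≤ _ := norm_sub_le _ _
      _ ≤ _ := by
          rw [norm_mul, norm_mul, norm_mul, Complex.norm_conj, Complex.norm_intCast,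
            abs_of_pos (by linarith), add_mul]
          gcongr
  · have e : (n : ℂ) * (β * s + α * t)
        = conj y₁ * (x₂ * s + x₁ * t) - y₂ * (conj x₁ * s + c * conj x₂ * t) := by
      linear_combination t * hα + s * hβ
    calc _ ≤ ‖(n : ℂ)‖ * ‖β * s + α * t‖ :=
          le_mul_of_one_le_left (norm_nonneg _) hn1
      _ = _ := by rw [← norm_mul, e]
      _ ≤ _ := norm_sub_le _ _
      _ ≤ _ := by
          have hD : 0 ≤ D := (norm_nonneg _).trans h1
          rw [norm_mul, norm_mul, Complex.norm_conj, add_mul]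
          have : ‖y₂‖ * D ≤ c * ‖y₂‖ * D := by
            rw [mul_assoc]
            exact le_mul_of_one_le_left (by positivity) hc1
          have h3 : ‖y₁‖ * ‖x₂ * s + x₁ * t‖ ≤ ‖y₁‖ * D := by gcongr
          have h4 : ‖y₂‖ * ‖conj x₁ * s + c * conj x₂ * t‖ ≤ ‖y₂‖ * D := by gcongr
          linarith

/-- The group of norm one elements of the quaternion order that are congruent to `1` modulo `N`
acts cocompactly on the hyperboloid `|s|² - c|t|² = 1`. -/
theorem exists_unit_translate_bounded_uniform {c : ℤ} (hc : c % 4 = 2) (hc0 : 0 < c) {N : ℕ}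
    (hN : N ≠ 0) :
    ∃ C : ℝ, ∀ s t : ℂ, ‖s‖ ^ 2 - c * ‖t‖ ^ 2 = 1 →
      ∃ α ∈ OF, ∃ β ∈ OF, ‖1 + N * α‖ ^ 2 - c * ‖N * β‖ ^ 2 = 1 ∧
        ‖conj (1 + N * α) * s + c * conj (N * β) * t‖ ≤ C ∧
        ‖N * β * s + (1 + N * α) * t‖ ≤ C := by
  have hc1 : (1 : ℝ) ≤ c := by exact_mod_cast hc0
  set D : ℝ := 4 + 2 * c with hD
  obtain ⟨B, hB⟩ := exists_nat_ge (D ^ 2 * (1 + c))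
  have hM : N * B.factorial ≠ 0 := mul_ne_zero hN B.factorial_ne_zero
  have : NeZero (N * B.factorial) := ⟨hM⟩
  -- A pair of Eisenstein integers is classified by its norm and its residues. The norm is at most
  -- `B` in absolute value, hence divides the factor `B!` of the modulus.
  have key : ∀ κ : Finset.Icc (-B : ℤ) B × (Fin 4 → ZMod (N * B.factorial)),
      ∃ C : ℝ, ∀ a : Fin 4 → ℤ, ∀ s t : ℂ, (κ.1 : ℤ) ≠ 0 →
        ‖(a 0 + a 1 * rho : ℂ)‖ ^ 2 - c * ‖(a 2 + a 3 * rho : ℂ)‖ ^ 2 = (κ.1 : ℤ) →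
        (∀ i, (a i : ZMod (N * B.factorial)) = κ.2 i) →
        ‖conj (a 0 + a 1 * rho) * s + c * conj (a 2 + a 3 * rho) * t‖ ≤ D →
        ‖(a 2 + a 3 * rho) * s + (a 0 + a 1 * rho) * t‖ ≤ D →
        ∃ α ∈ OF, ∃ β ∈ OF, ‖1 + N * α‖ ^ 2 - c * ‖N * β‖ ^ 2 = 1 ∧
          ‖conj (1 + N * α) * s + c * conj (N * β) * t‖ ≤ C ∧
          ‖N * β * s + (1 + N * α) * t‖ ≤ C := by
    rintro ⟨⟨n, hn⟩, res⟩
    by_cases hex : ∃ b : Fin 4 → ℤ,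
        ‖(b 0 + b 1 * rho : ℂ)‖ ^ 2 - c * ‖(b 2 + b 3 * rho : ℂ)‖ ^ 2 = n ∧
        ∀ i, (b i : ZMod (N * B.factorial)) = res i
    · obtain ⟨b, hb, hbr⟩ := hex
      refine ⟨(‖(b 0 + b 1 * rho : ℂ)‖ + c * ‖(b 2 + b 3 * rho : ℂ)‖) * D, ?_⟩
      intro a s t hn0 ha har h1 h2
      simp only at hn0 ha har
      obtain ⟨r, hr⟩ : n ∣ (B.factorial : ℤ) := by
        rw [← Int.natAbs_dvd_natAbs, Int.natAbs_natCast]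
        refine Nat.dvd_factorial (Int.natAbs_pos.mpr hn0) ?_
        rw [Finset.mem_Icc] at hn
        omega
      have hdvd : ∀ i, ∃ z : ℤ, a i = b i + n * r * N * z := fun i => by
        have := (har i).trans (hbr i).symm
        obtain ⟨z, hz⟩ := (ZMod.intCast_eq_intCast_iff_dvd_sub _ _ _).mp this.symm
        refine ⟨z, ?_⟩
        push_cast at hz
        rw [← hr]
        linarith
      choose z hz using hdvd
      have hzC : ∀ i, (a i : ℂ) = b i + n * r * N * z i := fun i => by
        rw [hz i]
        push_cast
        ring
      refine exists_unit_translate_bounded (r := r) (z₁ := z 0 + z 1 * rho)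
        (z₂ := z 2 + z 3 * rho) hc0 hn0 (mem_OF_iff.mpr ⟨_, _, rfl⟩) (mem_OF_iff.mpr ⟨_, _, rfl⟩)
        (mem_OF_iff.mpr ⟨_, _, rfl⟩) (mem_OF_iff.mpr ⟨_, _, rfl⟩) ?_ ?_ ha hb h1 h2
      · rw [hzC 0, hzC 1]
        ring
      · rw [hzC 2, hzC 3]
        ring
    · exact ⟨0, fun a s t _ ha har => absurd ⟨a, ha, har⟩ hex⟩
  choose C hC using key
  obtain ⟨C', hC'⟩ := Finite.exists_le C
  refine ⟨C', fun s t hst => ?_⟩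
  obtain ⟨x₁, hx₁, x₂, hx₂, hx0, h1, h2⟩ := exists_OF_translate_bounded hc0 hst
  obtain ⟨n, hn, hn_aniso⟩ := exists_int_norm_sub hc hx₁ hx₂
  have hn0 : n ≠ 0 := fun h => hx0 (hn_aniso h).1
  have hmul := norm_form_mul c x₁ x₂ s t
  rw [hst, mul_one, ← hn] at hmul
  have hnB : |n| ≤ B := by
    have : |(n : ℝ)| ≤ B := by
      refine le_trans ?_ hB
      have h1' : ‖conj x₁ * s + c * conj x₂ * t‖ ^ 2 ≤ D ^ 2 := by gcongr
      have h2' : ‖x₂ * s + x₁ * t‖ ^ 2 ≤ D ^ 2 := by gcongr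
      rw [← hmul, abs_le]
      have h3 := sq_nonneg ‖conj x₁ * s + c * conj x₂ * t‖
      have h4 := sq_nonneg ‖x₂ * s + x₁ * t‖
      have h5 := sq_nonneg D
      constructor <;> nlinarith
    exact_mod_cast this
  obtain ⟨a, b, rfl⟩ := mem_OF_iff.mp hx₁
  obtain ⟨d, e, rfl⟩ := mem_OF_iff.mp hx₂
  obtain ⟨α, hα, β, hβ, h3, h4, h5⟩ := hC
    (⟨n, Finset.mem_Icc.mpr (abs_le.mp hnB)⟩, fun i => ((![a, b, d, e] i : ℤ) : ZMod _))
    ![a, b, d, e] s t hn0 (by simpa using hn.symm) (fun i => rfl) (by simpa using h1)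
    (by simpa using h2)
  exact ⟨α, hα, β, hβ, h3, h4.trans (hC' _), h5.trans (hC' _)⟩

/-! ### Unit groups of quaternion orders inside the Picard modular group -/

/-- The first vector `x` of an orthogonal basis of the hermitian plane `n^⊥`. With
`T = 2 Re (n₀ n̄₁)` its norm is `-T`, so it is negative for `T > 0`. -/
noncomputable def planeX (n : Fin 3 → ℂ) : Fin 3 → ℂ := ![conj (n 0), -conj (n 1), 0]

/-- The second vector `ℓ` of an orthogonal basis of the hermitian plane `n^⊥`: the hermitian cross
product of `n` and `planeX n`, of norm `T h(n)`. -/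
noncomputable def planeL (n : Fin 3 → ℂ) : Fin 3 → ℂ :=
  ![conj (n 2) * n 0, conj (n 2) * n 1, -(n 0 * conj (n 1) + conj (n 0) * n 1)]

/-- The sesquilinear form with `herm z z = hermForm z`, linear in its first argument. -/
noncomputable def herm (y z : Fin 3 → ℂ) : ℂ :=
  y 0 * conj (z 1) + y 1 * conj (z 0) + y 2 * conj (z 2)

theorem hermForm_re (z : Fin 3 → ℂ) :
    hermForm z = (((2 * (z 0 * conj (z 1)).re + ‖z 2‖ ^ 2 : ℝ)) : ℂ) := by
  have h := Complex.add_conj (z 0 * conj (z 1))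
  rw [map_mul, Complex.conj_conj] at h
  rw [hermForm, h, Complex.mul_conj']
  push_cast
  ring

section

variable {n : Fin 3 → ℂ} {T c : ℂ}

theorem hermForm_basis (hT : n 0 * conj (n 1) + conj (n 0) * n 1 = T)
    (hc : T + n 2 * conj (n 2) = c) (s t r : ℂ) :
    hermForm (s • planeX n + t • planeL n + r • n)
      = -T * (s * conj s) + T * c * (t * conj t) + c * (r * conj r) := by
  rw [← hc, ← hT]
  simp [hermForm, planeX, planeL]
  ring

theorem decompose_basis (hT : n 0 * conj (n 1) + conj (n 0) * n 1 = T)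
    (hc : T + n 2 * conj (n 2) = c) (hT0 : T ≠ 0) (hc0 : c ≠ 0) (y : Fin 3 → ℂ) :
    y = (herm y (planeX n) / (-T)) • planeX n + (herm y (planeL n) / (T * c)) • planeL n
      + (herm y n / c) • n := by
  have key : ∀ i, T * c * y i = -(c * herm y (planeX n) * planeX n i)
      + herm y (planeL n) * planeL n i + T * herm y n * n i := by
    rw [← hc, ← hT]
    intro i
    fin_cases i <;> simp [herm, planeX, planeL] <;> ring
  funext i
  have := key i
  simp only [Pi.add_apply, Pi.smul_apply, smul_eq_mul]
  field_simp
  linear_combination this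

/-- The endomorphism `E` of `ℂ³` such that `1 + 3 E` is the element `(1 + N α, N β)`, `N = 3 T c`,
of the quaternion algebra acting on `n^⊥` and fixes `n`. -/
noncomputable def quatMat (n : Fin 3 → ℂ) (c α β : ℂ) : Matrix (Fin 3) (Fin 3) ℂ :=
  Matrix.of fun i k =>
    -(c * ![conj (planeX n 1), conj (planeX n 0), conj (planeX n 2)] k
        * (conj α * planeX n i + β * planeL n i))
      + ![conj (planeL n 1), conj (planeL n 0), conj (planeL n 2)] k
        * (α * planeL n i + c * conj β * planeX n i)

theorem quatMat_mulVec (n : Fin 3 → ℂ) (c α β : ℂ) (y : Fin 3 → ℂ) :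
    quatMat n c α β *ᵥ y = -(c * herm y (planeX n)) • (conj α • planeX n + β • planeL n)
      + herm y (planeL n) • (α • planeL n + (c * conj β) • planeX n) := by
  funext i
  simp only [quatMat, herm, mulVec, dotProduct, Fin.sum_univ_three, of_apply, Pi.add_apply,
    Pi.smul_apply, smul_eq_mul, cons_val_zero, cons_val_one, cons_val]
  ring

theorem herm_planeX_planeX (hT : n 0 * conj (n 1) + conj (n 0) * n 1 = T) :
    herm (planeX n) (planeX n) = -T := by
  rw [← hT]
  simp [herm, planeX]
  ring

theorem herm_planeX_planeL : herm (planeX n) (planeL n) = 0 := by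
  simp [herm, planeX, planeL]
  ring

theorem herm_planeL_planeX : herm (planeL n) (planeX n) = 0 := by
  simp [herm, planeX, planeL]
  ring

theorem herm_planeL_planeL (hT : n 0 * conj (n 1) + conj (n 0) * n 1 = T)
    (hc : T + n 2 * conj (n 2) = c) : herm (planeL n) (planeL n) = T * c := by
  rw [← hc, ← hT]
  simp [herm, planeL]
  ring

theorem herm_self_planeX : herm n (planeX n) = 0 := by
  simp [herm, planeX]
  ring

theorem herm_self_planeL : herm n (planeL n) = 0 := by
  simp [herm, planeL]
  ring

theorem one_add_quatMat_mulVec (hT : n 0 * conj (n 1) + conj (n 0) * n 1 = T)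
    (hc : T + n 2 * conj (n 2) = c) {N : ℕ} (hN : (N : ℂ) = 3 * T * c) (α β s t r : ℂ) :
    (1 + (3 : ℂ) • quatMat n c α β) *ᵥ (s • planeX n + t • planeL n + r • n)
      = (conj (1 + N * α) * s + c * conj (N * β) * t) • planeX n
        + (N * β * s + (1 + N * α) * t) • planeL n + r • n := by
  have hX : herm (s • planeX n + t • planeL n + r • n) (planeX n) = -T * s := by
    have : herm (s • planeX n + t • planeL n + r • n) (planeX n) = s * herm (planeX n) (planeX n)
        + t * herm (planeL n) (planeX n) + r * herm n (planeX n) := by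
      simp only [herm, Pi.add_apply, Pi.smul_apply, smul_eq_mul]
      ring
    rw [this, herm_planeX_planeX hT, herm_planeL_planeX, herm_self_planeX]
    ring
  have hL : herm (s • planeX n + t • planeL n + r • n) (planeL n) = T * c * t := by
    have : herm (s • planeX n + t • planeL n + r • n) (planeL n) = s * herm (planeX n) (planeL n)
        + t * herm (planeL n) (planeL n) + r * herm n (planeL n) := by
      simp only [herm, Pi.add_apply, Pi.smul_apply, smul_eq_mul]
      ring
    rw [this, herm_planeX_planeL, herm_planeL_planeL hT hc, herm_self_planeL]
    ring
  rw [add_mulVec, one_mulVec, smul_mulVec, quatMat_mulVec, hX, hL]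
  funext i
  simp only [Pi.add_apply, Pi.smul_apply, smul_eq_mul, map_add, map_mul, map_one, map_natCast]
  rw [hN]
  ring

/-- The determinant is computed in the basis `x, ℓ, n`. -/
theorem det_one_add_quatMat (hT : n 0 * conj (n 1) + conj (n 0) * n 1 = T)
    (hc : T + n 2 * conj (n 2) = c) (hT0 : T ≠ 0) (hc0 : c ≠ 0) {N : ℕ}
    (hN : (N : ℂ) = 3 * T * c) (α β : ℂ) :
    (1 + (3 : ℂ) • quatMat n c α β).det
      = (1 + N * α) * conj (1 + N * α) - c * ((N * β) * conj (N * β)) := by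
  set A := 1 + (3 : ℂ) • quatMat n c α β with hA
  have hx := one_add_quatMat_mulVec hT hc hN α β 1 0 0
  have hl := one_add_quatMat_mulVec hT hc hN α β 0 1 0
  have hn := one_add_quatMat_mulVec hT hc hN α β 0 0 1
  rw [← hA] at hx hl hn
  let P : Matrix (Fin 3) (Fin 3) ℂ := (Matrix.of ![planeX n, planeL n, n])ᵀ
  let K : Matrix (Fin 3) (Fin 3) ℂ := !![conj (1 + N * α), c * conj (N * β), 0;
    N * β, 1 + N * α, 0; 0, 0, 1]
  have hAP : A * P = P * K := by
    ext i k
    fin_cases k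
    · have := congrFun hx i
      simp only [mulVec, dotProduct, Fin.sum_univ_three, Pi.add_apply, Pi.smul_apply,
        smul_eq_mul] at this
      simp [Matrix.mul_apply, Fin.sum_univ_three, P, K]
      simp at this
      linear_combination this
    · have := congrFun hl i
      simp only [mulVec, dotProduct, Fin.sum_univ_three, Pi.add_apply, Pi.smul_apply,
        smul_eq_mul] at this
      simp [Matrix.mul_apply, Fin.sum_univ_three, P, K]
      simp at this
      linear_combination this
    · have := congrFun hn i
      simp only [mulVec, dotProduct, Fin.sum_univ_three, Pi.add_apply, Pi.smul_apply,
        smul_eq_mul] at this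
      simp [Matrix.mul_apply, Fin.sum_univ_three, P, K]
      simp at this
      linear_combination this
  have hP : P.det ≠ 0 := by
    have : P.det = T * c := by
      rw [← hc, ← hT]
      simp [P, Matrix.det_fin_three, planeX, planeL]
      ring
    rw [this]
    exact mul_ne_zero hT0 hc0
  have hK : K.det = (1 + N * α) * conj (1 + N * α) - c * ((N * β) * conj (N * β)) := by
    simp [K, Matrix.det_fin_three]
    ring
  have hdet := congrArg Matrix.det hAP
  rw [det_mul, det_mul, mul_comm] at hdet
  rw [← hK]
  exact mul_left_cancel₀ hP hdet

theorem hermForm_one_add_quatMat (hT : n 0 * conj (n 1) + conj (n 0) * n 1 = T)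
    (hc : T + n 2 * conj (n 2) = c) (hT0 : T ≠ 0) (hc0 : c ≠ 0) {N : ℕ}
    (hN : (N : ℂ) = 3 * T * c) {α β : ℂ} (hcc : conj c = c)
    (h : (1 + N * α) * conj (1 + N * α) - c * ((N * β) * conj (N * β)) = 1) (z : Fin 3 → ℂ) :
    hermForm ((1 + (3 : ℂ) • quatMat n c α β) *ᵥ z) = hermForm z := by
  rw [decompose_basis hT hc hT0 hc0 z, one_add_quatMat_mulVec hT hc hN,
    hermForm_basis hT hc, hermForm_basis hT hc]
  generalize herm z (planeX n) / (-T) = s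
  generalize herm z (planeL n) / (T * c) = t
  generalize (1 + N * α : ℂ) = a at h ⊢
  generalize (N * β : ℂ) = b at h ⊢
  simp only [map_add, map_mul, Complex.conj_conj, hcc]
  linear_combination (-T * (s * conj s) + T * c * (t * conj t)) * h

end

theorem three_mem_idealSqrtNeg3 : (3 : OF) ∈ idealSqrtNeg3 := by
  rw [idealSqrtNeg3, Ideal.mem_span_singleton']
  refine ⟨-⟨sqrtNeg3, sqrtNeg3_mem⟩, Subtype.ext ?_⟩
  have h : (Real.sqrt 3 : ℂ) ^ 2 = 3 := by
    exact_mod_cast Real.sq_sqrt (by norm_num : (0 : ℝ) ≤ 3)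
  change -sqrtNeg3 * sqrtNeg3 = 3
  rw [sqrtNeg3]
  linear_combination (-Complex.I ^ 2) * h - 3 * Complex.I_sq

theorem exists_mem_Gam1SqrtNeg3 {E : Matrix (Fin 3) (Fin 3) ℂ} (hE : ∀ i k, E i k ∈ OF)
    (hdet : (1 + (3 : ℂ) • E).det = 1)
    (hh : ∀ z, hermForm ((1 + (3 : ℂ) • E) *ᵥ z) = hermForm z) :
    ∃ g ∈ Gam1SqrtNeg3, g.1.1 = 1 + (3 : ℂ) • E := by
  let E' : Matrix (Fin 3) (Fin 3) OF := Matrix.of fun i k => ⟨E i k, hE i k⟩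
  let A' : Matrix (Fin 3) (Fin 3) OF := 1 + (3 : OF) • E'
  have hA' : A'.map (algebraMap OF ℂ) = 1 + (3 : ℂ) • E := by
    ext i k
    by_cases hik : i = k
    · subst hik
      simp [A', E']
      exact Or.inl rfl
    · simp [A', E', hik]
      exact Or.inl rfl
  have hdet' : A'.det = 1 := by
    apply Subtype.val_injective
    have := RingHom.map_det (algebraMap OF ℂ) A'
    rw [RingHom.mapMatrix_apply, hA', hdet] at this
    exact this
  let G' : GL (Fin 3) OF := Matrix.GeneralLinearGroup.mk'' A' (by rw [hdet']; exact isUnit_one)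
  let G : GL (Fin 3) ℂ := Matrix.GeneralLinearGroup.map (n := Fin 3) (algebraMap OF ℂ) G'
  have hG : G.1 = 1 + (3 : ℂ) • E := hA'
  have hU : ∀ z, hermForm (G.1 *ᵥ z) = hermForm z := by
    rw [hG]
    exact hh
  have hmem : G ∈ GUPlus := ⟨1, one_pos, fun z => by rw [hU]; simp⟩
  refine ⟨⟨G, hmem⟩, ⟨⟨⟨⟨G', rfl⟩, hU⟩, ?_⟩, ⟨G', ?_, rfl⟩⟩, hG⟩
  · refine Units.ext ?_
    change G.1.det = 1
    rw [hG, hdet]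
  · refine Units.ext ?_
    ext i k
    have h3 : Ideal.Quotient.mk idealSqrtNeg3 3 = 0 :=
      Ideal.Quotient.eq_zero_iff_mem.mpr three_mem_idealSqrtNeg3
    change Ideal.Quotient.mk idealSqrtNeg3 (A' i k) = (1 : Matrix _ _ _) i k
    have : A' i k = (1 : Matrix (Fin 3) (Fin 3) OF) i k + 3 * E' i k := rfl
    rw [this, map_add, map_mul, h3, zero_mul, add_zero]
    by_cases hik : i = k
    · subst hik
      simp
    · simp [hik]

theorem quatMat_mem_OF {n : Fin 3 → ℂ} (hn : ∀ i, n i ∈ OF) (c : ℤ) {α β : ℂ} (hα : α ∈ OF)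
    (hβ : β ∈ OF) (i k : Fin 3) : quatMat n c α β i k ∈ OF := by
  have hX : ∀ i, planeX n i ∈ OF := fun i => by
    fin_cases i
    · exact conj_mem_OF (hn 0)
    · exact neg_mem (conj_mem_OF (hn 1))
    · exact zero_mem _
  have hL : ∀ i, planeL n i ∈ OF := fun i => by
    fin_cases i
    · exact mul_mem (conj_mem_OF (hn 2)) (hn 0)
    · exact mul_mem (conj_mem_OF (hn 2)) (hn 1)
    · exact neg_mem (add_mem (mul_mem (hn 0) (conj_mem_OF (hn 1)))
        (mul_mem (conj_mem_OF (hn 0)) (hn 1)))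
  have hflip : ∀ {y : Fin 3 → ℂ}, (∀ i, y i ∈ OF) →
      ∀ k, ![conj (y 1), conj (y 0), conj (y 2)] k ∈ OF := fun hy k => by
    fin_cases k
    · exact conj_mem_OF (hy 1)
    · exact conj_mem_OF (hy 0)
    · exact conj_mem_OF (hy 2)
  have hcm : (c : ℂ) ∈ OF := intCast_mem _ c
  exact add_mem
    (neg_mem (mul_mem (mul_mem hcm (hflip hX k))
      (add_mem (mul_mem (conj_mem_OF hα) (hX i)) (mul_mem hβ (hL i)))))
    (mul_mem (hflip hL k)
      (add_mem (mul_mem hα (hL i)) (mul_mem (mul_mem hcm (conj_mem_OF hβ)) (hX i))))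

/-- The elements of norm one of the quaternion order that are congruent to `1` modulo `N = 3 T c`
act on `n^⊥` through elements of `Γ₁[√-3]` that fix `n`. -/
theorem exists_mem_Gam1SqrtNeg3_quaternion {n : Fin 3 → ℂ} (hn : ∀ i, n i ∈ OF) {T c : ℤ}
    (hT : n 0 * conj (n 1) + conj (n 0) * n 1 = T) (hc : T + n 2 * conj (n 2) = c)
    (hT0 : T ≠ 0) (hc0 : c ≠ 0) {N : ℕ} (hN : (N : ℤ) = 3 * T * c) {α β : ℂ} (hα : α ∈ OF)
    (hβ : β ∈ OF) (h : ‖1 + N * α‖ ^ 2 - c * ‖N * β‖ ^ 2 = 1) :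
    ∃ g ∈ Gam1SqrtNeg3, ∀ s t r : ℂ, g.1.1 *ᵥ (s • planeX n + t • planeL n + r • n)
      = (conj (1 + N * α) * s + c * conj (N * β) * t) • planeX n
        + (N * β * s + (1 + N * α) * t) • planeL n + r • n := by
  have hNC : (N : ℂ) = 3 * T * c := by exact_mod_cast congrArg (Int.cast : ℤ → ℂ) hN
  have hTC : (T : ℂ) ≠ 0 := by exact_mod_cast hT0
  have hcC : (c : ℂ) ≠ 0 := by exact_mod_cast hc0
  have hC : (1 + N * α) * conj (1 + N * α) - c * ((N * β) * conj (N * β)) = 1 := by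
    rw [Complex.mul_conj', Complex.mul_conj']
    exact_mod_cast h
  obtain ⟨g, hg, hgE⟩ := exists_mem_Gam1SqrtNeg3 (quatMat_mem_OF hn c hα hβ)
    (by rw [det_one_add_quatMat hT hc hTC hcC hNC, hC])
    (hermForm_one_add_quatMat hT hc hTC hcC hNC (by simp) hC)
  exact ⟨g, hg, fun s t r => by rw [hgE, one_add_quatMat_mulVec hT hc hNC]⟩

/-! ### Modular forms as functions of two vectors -/

theorem eval_eq_sum_of_isHomogeneous {j : ℕ} {P : MvPolynomial (Fin 2) ℂ}
    (hP : P.IsHomogeneous j) (e : Fin 2 → ℂ) :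
    MvPolynomial.eval e P = ∑ d ∈ Finset.finsuppAntidiag (Finset.univ : Finset (Fin 2)) j,
      P.coeff d * (e 0 ^ d 0 * e 1 ^ d 1) := by
  rw [MvPolynomial.eval_eq']
  simp only [Fin.prod_univ_two]
  refine Finset.sum_subset (fun d hd => ?_) fun d _ hd => ?_
  · rw [Finset.mem_finsuppAntidiag]
    refine ⟨?_, Finset.subset_univ _⟩
    have := hP (MvPolynomial.mem_support_iff.mp hd)
    rw [Finsupp.weight_apply, Finsupp.sum_fintype _ _ (by simp)] at this
    simpa using this
  · rw [MvPolynomial.notMem_support_iff.mp hd, zero_mul]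

theorem eval_smul_of_isHomogeneous {j : ℕ} {P : MvPolynomial (Fin 2) ℂ} (hP : P.IsHomogeneous j)
    (a : ℂ) (e : Fin 2 → ℂ) :
    MvPolynomial.eval (a • e) P = a ^ j * MvPolynomial.eval e P := by
  rw [eval_eq_sum_of_isHomogeneous hP, eval_eq_sum_of_isHomogeneous hP, Finset.mul_sum]
  refine Finset.sum_congr rfl fun d hd => ?_
  have h := (Finset.mem_finsuppAntidiag.mp hd).1
  rw [Fin.sum_univ_two] at h
  rw [← h, pow_add]
  simp only [Pi.smul_apply, smul_eq_mul, mul_pow]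
  ring

theorem eval_symAlg (A : Matrix (Fin 2) (Fin 2) ℂ) (P : MvPolynomial (Fin 2) ℂ) (e : Fin 2 → ℂ) :
    MvPolynomial.eval e (symAlg A P) = MvPolynomial.eval (Aᵀ *ᵥ e) P := by
  induction P using MvPolynomial.induction_on with
  | C a => simp [symAlg]
  | add p q hp hq => rw [map_add, map_add, map_add, hp, hq]
  | mul_X p i hp =>
    rw [map_mul, map_mul, map_mul, hp]
    fin_cases i <;> simp [symAlg]

variable {j : ℕ} {k : ℤ}

/-- The coefficient of a map `B → Sym^j(ℂ²)` at a monomial, extended by zero to `ℂ²`. -/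
noncomputable def coeffExt (f : ball → SymPow j) (d : Fin 2 →₀ ℕ) : ℂ × ℂ → ℂ :=
  Function.extend Subtype.val (fun p => MvPolynomial.coeff d (f p).1) 0

/-- The homogeneous version of a map `f : B → Sym^j(ℂ²)`: a function of a vector `X` spanning the
line `(u,v) = (X₂/X₁, X₀/X₁)` and of a second vector `q`. The factor `j₂` describes the action on
linear forms that vanish on the line of `X`, in the basis `y₂, y₀`, so `f(u,v)` is a polynomial
on `ℂ³ / ℂ X`; it is evaluated at the class of `q`, and scaled by `X₁^(-k)`. -/
noncomputable def homogForm (k : ℤ) (f : ball → SymPow j) (X q : Fin 3 → ℂ) : ℂ :=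
  X 1 ^ (-k) * ∑ d ∈ Finset.finsuppAntidiag (Finset.univ : Finset (Fin 2)) j,
    coeffExt f d (X 2 / X 1, X 0 / X 1) *
      ((q 2 - X 2 / X 1 * q 1) ^ d 0 * (q 0 - X 0 / X 1 * q 1) ^ d 1)

theorem homogForm_eq_eval (f : ball → SymPow j) {X : Fin 3 → ℂ} {p : ball}
    (hp : (X 2 / X 1, X 0 / X 1) = p.1) (q : Fin 3 → ℂ) :
    homogForm k f X q = X 1 ^ (-k) *
      MvPolynomial.eval ![q 2 - p.1.1 * q 1, q 0 - p.1.2 * q 1] (f p).1 := by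
  have h1 : X 2 / X 1 = p.1.1 := congrArg Prod.fst hp
  have h2 : X 0 / X 1 = p.1.2 := congrArg Prod.snd hp
  rw [homogForm, eval_eq_sum_of_isHomogeneous (f p).2, h1, h2]
  congr 1
  refine Finset.sum_congr rfl fun d _ => ?_
  rw [coeffExt, Prod.mk.eta, Subtype.val_injective.extend_apply]
  simp

theorem homogForm_smul_left (f : ball → SymPow j) {a : ℂ} (ha : a ≠ 0) (X q : Fin 3 → ℂ) :
    homogForm k f (a • X) q = a ^ (-k) * homogForm k f X q := by
  simp only [homogForm, Pi.smul_apply, smul_eq_mul, mul_div_mul_left _ _ ha, mul_zpow, mul_assoc]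

theorem homogForm_smul_right (f : ball → SymPow j) (a : ℂ) (X q : Fin 3 → ℂ) :
    homogForm k f X (a • q) = a ^ j * homogForm k f X q := by
  rw [homogForm, homogForm, mul_left_comm (a ^ j)]
  refine congrArg (X 1 ^ (-k) * ·) ?_
  rw [Finset.mul_sum]
  refine Finset.sum_congr rfl fun d hd => ?_
  have h := (Finset.mem_finsuppAntidiag.mp hd).1
  rw [Fin.sum_univ_two] at h
  have hpow : a ^ j = a ^ d 0 * a ^ d 1 := by rw [← pow_add, h]
  simp only [Pi.smul_apply, smul_eq_mul]
  rw [hpow, mul_left_comm (X 2 / X 1), mul_left_comm (X 0 / X 1), ← mul_sub, ← mul_sub,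
    mul_pow, mul_pow]
  ring

theorem hermForm_smul (a : ℂ) (z : Fin 3 → ℂ) :
    hermForm (a • z) = ((‖a‖ ^ 2 : ℝ) : ℂ) * hermForm z := by
  push_cast
  rw [← Complex.mul_conj']
  simp only [hermForm, Pi.smul_apply, smul_eq_mul, map_mul]
  ring

theorem apply_one_ne_zero_of_hermForm_neg {X : Fin 3 → ℂ} (hX : (hermForm X).re < 0) :
    X 1 ≠ 0 := by
  intro h
  rw [hermForm_re, h, Complex.ofReal_re] at hX
  simp only [map_zero, mul_zero, Complex.zero_re] at hX
  nlinarith [sq_nonneg ‖X 2‖]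

theorem smul_lift {X : Fin 3 → ℂ} (hX : X 1 ≠ 0) :
    X = X 1 • ![X 0 / X 1, 1, X 2 / X 1] := by
  funext i
  fin_cases i <;> simp [mul_div_cancel₀ _ hX]

theorem mem_ball_of_hermForm_neg {X : Fin 3 → ℂ} (hX : (hermForm X).re < 0) :
    (X 2 / X 1, X 0 / X 1) ∈ ball := by
  have h1 := apply_one_ne_zero_of_hermForm_neg hX
  have h := hermForm_lift (X 2 / X 1, X 0 / X 1)
  rw [smul_lift h1, hermForm_smul, h, Complex.re_ofReal_mul, Complex.ofReal_re] at hX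
  exact (mul_neg_iff.mp hX).resolve_right (fun h' => (sq_nonneg _).not_gt h'.1) |>.2

/-- The matrix `j₂` is the action of `g` on the linear forms that vanish on a line. -/
theorem transpose_j₂_mulVec (g : GL (Fin 3) ℂ) {p : ℂ × ℂ} (hp : j₁ g.1 p ≠ 0) (q : Fin 3 → ℂ) :
    (j₂ g.1 p)ᵀ *ᵥ ![(g.1 *ᵥ q) 2 - (actCoord g.1 p).1 * (g.1 *ᵥ q) 1,
        (g.1 *ᵥ q) 0 - (actCoord g.1 p).2 * (g.1 *ᵥ q) 1]
      = ![q 2 - p.1 * q 1, q 0 - p.2 * q 1] := by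
  have hd : g.1.det ≠ 0 := ((Matrix.isUnit_iff_isUnit_det _).mp g.isUnit).ne_zero
  have key : ∀ a b : ℂ, ∀ i, (j₂ g.1 p)ᵀ.mulVec ![a, b] i * g.1.det
      = ![(minor g.1 2 1 * p.1 + minor g.1 2 2) * a + (minor g.1 0 1 * p.1 + minor g.1 0 2) * b,
        (minor g.1 2 1 * p.2 + minor g.1 2 0) * a + (minor g.1 0 1 * p.2 + minor g.1 0 0) * b] i := by
    intro a b i
    fin_cases i <;> simp [j₂, mulVec, dotProduct, Fin.sum_univ_two] <;> field_simp
  funext i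
  refine mul_right_cancel₀ hd ?_
  rw [key]
  simp only [actCoord]
  refine mul_right_cancel₀ hp ?_
  fin_cases i <;>
  · simp only [Fin.zero_eta, Fin.mk_one, cons_val_zero, cons_val_one]
    field_simp
    simp [minor, j₁, mulVec, dotProduct, Fin.sum_univ_three, Matrix.det_fin_two,
      Matrix.det_fin_three, Fin.succAbove, Fin.lt_def]
    ring

/-- Modularity of `f` is invariance of its homogeneous version: the factor `j₁^k` is absorbed by
`X₁^(-k)` and the factor `Sym^j(j₂)` by the simultaneous action on the second vector. -/
theorem homogForm_mulVec {Γs : Subgroup GUPlus} {f : ball → SymPow j}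
    (hf : f ∈ modularForms j k Γs) {g : GUPlus} (hg : g ∈ Γs) {X : Fin 3 → ℂ}
    (hX : (hermForm X).re < 0) (q : Fin 3 → ℂ) :
    homogForm k f (g.1.1 *ᵥ X) (g.1.1 *ᵥ q) = homogForm k f X q := by
  have h1 := apply_one_ne_zero_of_hermForm_neg hX
  set p : ball := ⟨_, mem_ball_of_hermForm_neg hX⟩ with hp
  have hj : j₁ g.1.1 p.1 ≠ 0 := j₁_ne_zero g p
  have hgX : g.1.1 *ᵥ X = X 1 • ![g.1.1 0 0 * p.1.2 + g.1.1 0 1 + g.1.1 0 2 * p.1.1,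
      j₁ g.1.1 p.1, g.1.1 2 0 * p.1.2 + g.1.1 2 1 + g.1.1 2 2 * p.1.1] := by
    rw [← mulVec_lift, ← mulVec_smul]
    congr 1
    exact smul_lift h1
  have hact : ((g.1.1 *ᵥ X) 2 / (g.1.1 *ᵥ X) 1, (g.1.1 *ᵥ X) 0 / (g.1.1 *ᵥ X) 1)
      = (act g p).1 := by
    rw [hgX]
    simp only [Pi.smul_apply, smul_eq_mul, mul_div_mul_left _ _ h1]
    rfl
  rw [homogForm_eq_eval f hact, homogForm_eq_eval f (p := p) rfl]
  have hslash := congrFun (hf.2 g hg) p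
  change j₁ g.1.1 p.1 ^ (-k) • symPow j (j₂ g.1.1 p.1)⁻¹ (f (act g p)) = f p at hslash
  have hdet : IsUnit (j₂ g.1.1 p.1).det := by
    rw [det_j₂, isUnit_iff_ne_zero]
    exact mul_ne_zero hj
      (inv_ne_zero ((Matrix.isUnit_iff_isUnit_det _).mp g.1.isUnit).ne_zero)
  have hinv : ((j₂ g.1.1 p.1)⁻¹)ᵀ *ᵥ ![q 2 - p.1.1 * q 1, q 0 - p.1.2 * q 1]
      = ![(g.1.1 *ᵥ q) 2 - (act g p).1.1 * (g.1.1 *ᵥ q) 1,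
        (g.1.1 *ᵥ q) 0 - (act g p).1.2 * (g.1.1 *ᵥ q) 1] := by
    rw [← transpose_j₂_mulVec g.1 hj q, mulVec_mulVec, ← transpose_mul,
      Matrix.mul_nonsing_inv _ hdet, transpose_one, one_mulVec]
    rfl
  have hfp : (f p).1 = j₁ g.1.1 p.1 ^ (-k) • symAlg (j₂ g.1.1 p.1)⁻¹ (f (act g p)).1 := by
    rw [← hslash]
    rfl
  rw [hfp, MvPolynomial.smul_eval, eval_symAlg, hinv, hgX]
  simp only [Pi.smul_apply, smul_eq_mul, cons_val_one, cons_val_zero, mul_zpow]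
  ring

theorem isOpen_ball : IsOpen ball :=
  isOpen_lt (by fun_prop) continuous_const

theorem differentiableAt_coeffExt {f : ball → SymPow j} (hf : IsHolomorphic f)
    (d : Fin 2 →₀ ℕ) {p : ℂ × ℂ} (hp : p ∈ ball) : DifferentiableAt ℂ (coeffExt f d) p :=
  (hf ((MvPolynomial.lcoeff ℂ d).comp (Submodule.subtype _)) p hp).differentiableAt
    (isOpen_ball.mem_nhds hp)

theorem differentiableAt_homogForm {f : ball → SymPow j} (hf : IsHolomorphic f)
    {Z : (Fin 3 → ℂ) × (Fin 3 → ℂ)} (hZ : (hermForm Z.1).re < 0) :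
    DifferentiableAt ℂ (fun Z : (Fin 3 → ℂ) × (Fin 3 → ℂ) => homogForm k f Z.1 Z.2) Z := by
  have h1 := apply_one_ne_zero_of_hermForm_neg hZ
  have hX : ∀ i, DifferentiableAt ℂ (fun Z : (Fin 3 → ℂ) × (Fin 3 → ℂ) => Z.1 i) Z :=
    fun i => by fun_prop
  have hq : ∀ i, DifferentiableAt ℂ (fun Z : (Fin 3 → ℂ) × (Fin 3 → ℂ) => Z.2 i) Z :=
    fun i => by fun_prop
  have hdiv : ∀ i, DifferentiableAt ℂ (fun Z : (Fin 3 → ℂ) × (Fin 3 → ℂ) => Z.1 i / Z.1 1) Z :=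
    fun i => by
      simp only [div_eq_mul_inv]
      exact (hX i).mul ((hX 1).inv h1)
  unfold homogForm
  refine ((hX 1).zpow (Or.inl h1)).mul (DifferentiableAt.fun_sum fun d _ => ?_)
  refine DifferentiableAt.mul ?_ ((((hq 2).sub ((hdiv 2).mul (hq 1))).pow _).mul
    (((hq 0).sub ((hdiv 0).mul (hq 1))).pow _))
  exact DifferentiableAt.comp (𝕜 := ℂ) Z (g := coeffExt f d)
    (f := fun Z : (Fin 3 → ℂ) × (Fin 3 → ℂ) => (Z.1 2 / Z.1 1, Z.1 0 / Z.1 1))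
    (differentiableAt_coeffExt hf d (mem_ball_of_hermForm_neg hZ)) ((hdiv 2).prodMk (hdiv 0))

/-! ### Vanishing on discs -/

/-- A holomorphic function on a disc dominated by `(1 - c|w|²)^(m/2)` times its value at the
centre, with `m > 0`, has a strict maximum there unless it vanishes. -/
theorem eq_zero_of_norm_le_sqrt_zpow {c : ℝ} (hc : 0 < c) {m : ℤ} (hm : 0 < m) {g : ℂ → ℂ}
    (hd : ∀ w : ℂ, c * ‖w‖ ^ 2 < 1 → DifferentiableAt ℂ g w)
    (hg : ∀ w : ℂ, c * ‖w‖ ^ 2 < 1 → ‖g w‖ ≤ √(1 - c * ‖w‖ ^ 2) ^ m * ‖g 0‖) : g 0 = 0 := by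
  have hnhds : ∀ᶠ w : ℂ in nhds 0, c * ‖w‖ ^ 2 < 1 :=
    (isOpen_lt (by fun_prop) continuous_const).mem_nhds (by simp)
  lift m to ℕ using hm.le
  simp only [zpow_natCast] at hg
  have hm0 : m ≠ 0 := by
    rintro rfl
    simp at hm
  have hsqrt : ∀ w : ℂ, c * ‖w‖ ^ 2 < 1 → √(1 - c * ‖w‖ ^ 2) ^ m ≤ 1 := fun w _ =>
    pow_le_one₀ (Real.sqrt_nonneg _) (Real.sqrt_le_one.mpr (by nlinarith [sq_nonneg ‖w‖]))
  have hmax : IsLocalMax (norm ∘ g) 0 := by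
    filter_upwards [hnhds] with w hw
    exact (hg w hw).trans (mul_le_of_le_one_left (norm_nonneg _) (hsqrt w hw))
  have hconst := Complex.eventually_eq_of_isLocalMax_norm (hnhds.mono hd) hmax
  obtain ⟨w, ⟨hw, hw1⟩, hw0⟩ := (((hconst.and hnhds).filter_mono
    (nhdsWithin_le_nhds (s := {0}ᶜ))).and self_mem_nhdsWithin).exists
  have hpos : 0 < c * ‖w‖ ^ 2 := by
    have := norm_pos_iff.mpr hw0
    positivity
  have hlt : √(1 - c * ‖w‖ ^ 2) ^ m < 1 :=
    pow_lt_one₀ (Real.sqrt_nonneg _) ((Real.sqrt_lt' one_pos).mpr (by linarith)) hm0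
  have h := hg w hw1
  rw [hw] at h
  by_contra h0
  have := norm_pos_iff.mpr h0
  nlinarith

/-- A holomorphic function on the cone `|s|² > c|t|²`, homogeneous of degree `m > 0`, vanishes if
every point of the hyperboloid `|s|² - c|t|² = 1` can be moved to a fixed bounded set without
changing the value of the function. Its modulus attains a maximum over the hyperboloid, and the
line through the maximum in the orthogonal direction is a disc on which this is impossible. -/
theorem eq_zero_of_homogeneous_of_translate {c C : ℝ} (hc : 0 < c) {m : ℤ} (hm : 0 < m)
    {P : ℂ → ℂ → ℂ} (hsmul : ∀ r s t : ℂ, r ≠ 0 → P (r * s) (r * t) = r ^ m * P s t)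
    (hdiff : ∀ x : ℂ × ℂ, 0 < ‖x.1‖ ^ 2 - c * ‖x.2‖ ^ 2 →
      DifferentiableAt ℂ (fun x : ℂ × ℂ => P x.1 x.2) x)
    (hmove : ∀ s t : ℂ, ‖s‖ ^ 2 - c * ‖t‖ ^ 2 = 1 →
      ∃ s' t' : ℂ, ‖s'‖ ^ 2 - c * ‖t'‖ ^ 2 = 1 ∧ ‖s'‖ ≤ C ∧ ‖t'‖ ≤ C ∧ P s' t' = P s t)
    {s t : ℂ} (hst : 0 < ‖s‖ ^ 2 - c * ‖t‖ ^ 2) : P s t = 0 := by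
  let K : Set (ℂ × ℂ) := Metric.closedBall 0 C ∩ {x | ‖x.1‖ ^ 2 - c * ‖x.2‖ ^ 2 = 1}
  have hK : IsCompact K := (isCompact_closedBall _ _).inter_right
    (isClosed_eq (by fun_prop) continuous_const)
  have hKmem : ∀ s t : ℂ, ‖s‖ ^ 2 - c * ‖t‖ ^ 2 = 1 → ‖s‖ ≤ C → ‖t‖ ≤ C → (s, t) ∈ K := by
    intro s t h hs ht
    refine ⟨?_, h⟩
    rw [mem_closedBall_zero_iff, Prod.norm_mk]
    exact max_le hs ht
  have hKne : K.Nonempty := by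
    obtain ⟨s, t, h, hs, ht, -⟩ := hmove 1 0 (by simp)
    exact ⟨_, hKmem s t h hs ht⟩
  have hcont : ContinuousOn (fun x : ℂ × ℂ => ‖P x.1 x.2‖) K := fun x hx =>
    (hdiff x (by rw [hx.2]; exact one_pos)).continuousAt.norm.continuousWithinAt
  obtain ⟨⟨s₀, t₀⟩, hK₀, hmaxK⟩ := hK.exists_isMaxOn hKne hcont
  have hst₀ : ‖s₀‖ ^ 2 - c * ‖t₀‖ ^ 2 = 1 := hK₀.2
  have hmax : ∀ s t : ℂ, ‖s‖ ^ 2 - c * ‖t‖ ^ 2 = 1 → ‖P s t‖ ≤ ‖P s₀ t₀‖ := by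
    intro s t hst
    obtain ⟨s', t', h, hs, ht, hPst⟩ := hmove s t hst
    rw [← hPst]
    exact isMaxOn_iff.mp hmaxK (s', t') (hKmem s' t' h hs ht)
  have hcone : ∀ s t : ℂ, 0 < ‖s‖ ^ 2 - c * ‖t‖ ^ 2 →
      ‖P s t‖ ≤ √(‖s‖ ^ 2 - c * ‖t‖ ^ 2) ^ (m) * ‖P s₀ t₀‖ := by
    intro s t hst
    set r := √(‖s‖ ^ 2 - c * ‖t‖ ^ 2) with hr
    have hr0 : 0 < r := Real.sqrt_pos.mpr hst
    have hrC : (r : ℂ) ≠ 0 := by exact_mod_cast hr0.ne'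
    have hr2 : r ^ 2 = ‖s‖ ^ 2 - c * ‖t‖ ^ 2 := Real.sq_sqrt hst.le
    have h1 : P s t = (r : ℂ) ^ (m) * P (s / r) (t / r) := by
      rw [← hsmul _ _ _ hrC, mul_div_cancel₀ _ hrC, mul_div_cancel₀ _ hrC]
    rw [h1, norm_mul, norm_zpow, Complex.norm_real, Real.norm_of_nonneg hr0.le]
    refine mul_le_mul_of_nonneg_left (hmax _ _ ?_) (by positivity)
    rw [norm_div, norm_div, Complex.norm_real, Real.norm_of_nonneg hr0.le]
    field_simp
    linarith
  -- The line through `(s₀, t₀)` in the orthogonal direction `(c t̄₀, s̄₀)` of norm `-c`.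
  have hline : ∀ w : ℂ, ‖s₀ + w * (c * conj t₀)‖ ^ 2 - c * ‖t₀ + w * conj s₀‖ ^ 2
      = 1 - c * ‖w‖ ^ 2 := by
    intro w
    have h : (s₀ * conj s₀ - c * (t₀ * conj t₀) : ℂ) = 1 := by
      rw [Complex.mul_conj', Complex.mul_conj']
      exact_mod_cast hst₀
    apply Complex.ofReal_injective
    push_cast
    simp only [← Complex.mul_conj', map_add, map_mul, Complex.conj_conj, Complex.conj_ofReal]
    linear_combination (1 - c * (w * conj w)) * h
  have hzero : P s₀ t₀ = 0 := by
    have h := eq_zero_of_norm_le_sqrt_zpow hc hm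
      (g := fun w => P (s₀ + w * (c * conj t₀)) (t₀ + w * conj s₀)) ?_ ?_
    · simpa using h
    · intro w hw
      exact DifferentiableAt.comp (𝕜 := ℂ) w (g := fun x : ℂ × ℂ => P x.1 x.2)
        (f := fun w => (s₀ + w * (c * conj t₀), t₀ + w * conj s₀))
        (hdiff _ (by rw [hline]; linarith)) (by fun_prop)
    · intro w hw
      have h := hcone (s₀ + w * (c * conj t₀)) (t₀ + w * conj s₀) (by rw [hline]; linarith)
      rw [hline] at h
      simpa using h
  have h := hcone s t hst
  rw [hzero, norm_zero, mul_zero] at h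
  exact norm_le_zero_iff.mp h

theorem homogForm_eq_zero_of_orthogonal {f : ball → SymPow j}
    (hf : f ∈ modularForms j k Gam1SqrtNeg3) (hk : k < 0) {n : Fin 3 → ℂ} (hn : ∀ i, n i ∈ OF)
    {T c : ℤ} (hT : n 0 * conj (n 1) + conj (n 0) * n 1 = T) (hc : T + n 2 * conj (n 2) = c)
    (hT0 : 0 < T) (hc4 : c % 4 = 2) {X : Fin 3 → ℂ} (hX : (hermForm X).re < 0)
    (hXn : herm X n = 0) : homogForm k f X n = 0 := by
  have hTR : (0 : ℝ) < T := by exact_mod_cast hT0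
  have hc0 : 0 < c := by
    have h : ((T + ‖n 2‖ ^ 2 : ℝ) : ℂ) = ((c : ℝ) : ℂ) := by
      push_cast
      rw [← hc, Complex.mul_conj']
    have h' : (c : ℝ) = T + ‖n 2‖ ^ 2 := (Complex.ofReal_injective h).symm
    have : (0 : ℝ) < c := by rw [h']; positivity
    exact_mod_cast this
  have hcR : (0 : ℝ) < c := by exact_mod_cast hc0
  have hTC : (T : ℂ) ≠ 0 := by exact_mod_cast hT0.ne'
  have hcC : (c : ℂ) ≠ 0 := by exact_mod_cast hc0.ne'
  set V : ℂ → ℂ → Fin 3 → ℂ := fun s t => s • planeX n + t • planeL n with hV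
  have hVform : ∀ s t, hermForm (V s t) = ((-T * (‖s‖ ^ 2 - c * ‖t‖ ^ 2) : ℝ) : ℂ) := by
    intro s t
    have h := hermForm_basis hT hc s t 0
    rw [zero_smul, add_zero] at h
    rw [hV, h, Complex.mul_conj', Complex.mul_conj']
    push_cast
    simp
    ring
  have hVneg : ∀ s t, 0 < ‖s‖ ^ 2 - c * ‖t‖ ^ 2 → (hermForm (V s t)).re < 0 := by
    intro s t h
    rw [hVform, Complex.ofReal_re]
    nlinarith
  set P : ℂ → ℂ → ℂ := fun s t => homogForm k f (V s t) n with hP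
  have hPsmul : ∀ r s t : ℂ, r ≠ 0 → P (r * s) (r * t) = r ^ (-k) * P s t := by
    intro r s t hr
    have : V (r * s) (r * t) = r • V s t := by simp only [hV, smul_add, mul_smul]
    simp only [hP, this, homogForm_smul_left f hr]
  have hPdiff : ∀ x : ℂ × ℂ, 0 < ‖x.1‖ ^ 2 - c * ‖x.2‖ ^ 2 →
      DifferentiableAt ℂ (fun x : ℂ × ℂ => P x.1 x.2) x := by
    intro x hx
    exact DifferentiableAt.comp (𝕜 := ℂ) x
      (g := fun Z : (Fin 3 → ℂ) × (Fin 3 → ℂ) => homogForm k f Z.1 Z.2)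
      (f := fun x : ℂ × ℂ => (V x.1 x.2, n))
      (differentiableAt_homogForm hf.1 (hVneg _ _ hx)) (by simp only [hV]; fun_prop)
  have hN : (3 * T * c).toNat ≠ 0 := by
    have : 0 < 3 * T * c := by positivity
    omega
  have hNcast : ((3 * T * c).toNat : ℤ) = 3 * T * c := Int.toNat_of_nonneg (by positivity)
  obtain ⟨C, hC⟩ := exists_unit_translate_bounded_uniform hc4 hc0 hN
  have hmove : ∀ s t : ℂ, ‖s‖ ^ 2 - c * ‖t‖ ^ 2 = 1 →
      ∃ s' t' : ℂ, ‖s'‖ ^ 2 - c * ‖t'‖ ^ 2 = 1 ∧ ‖s'‖ ≤ C ∧ ‖t'‖ ≤ C ∧ P s' t' = P s t := by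
    intro s t hst
    obtain ⟨α, hα, β, hβ, hαβ, h1, h2⟩ := hC s t hst
    obtain ⟨g, hg, hgV⟩ :=
      exists_mem_Gam1SqrtNeg3_quaternion hn hT hc hT0.ne' hc0.ne' hNcast hα hβ hαβ
    refine ⟨_, _, ?_, h1, h2, ?_⟩
    · rw [norm_form_mul, hαβ, hst, one_mul]
    · have hgn := hgV 0 0 1
      have hgs := hgV s t 0
      simp only [mul_zero, zero_smul, zero_add, one_smul, add_zero] at hgn hgs
      have h := homogForm_mulVec hf hg (hVneg s t (by rw [hst]; exact one_pos)) n
      rw [hgn] at h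
      simp only [hP, hV]
      rw [← hgs]
      exact h
  have hXV : X = V (herm X (planeX n) / (-T)) (herm X (planeL n) / (T * c)) := by
    have h := decompose_basis hT hc hTC hcC X
    rw [hXn, zero_div, zero_smul, add_zero] at h
    exact h
  generalize herm X (planeX n) / (-T) = s at hXV
  generalize herm X (planeL n) / (T * c) = t at hXV
  subst hXV
  have hst : 0 < ‖s‖ ^ 2 - c * ‖t‖ ^ 2 := by
    rw [hVform, Complex.ofReal_re] at hX
    nlinarith
  exact eq_zero_of_homogeneous_of_translate hcR (by omega) hPsmul hPdiff hmove hst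

/-! ### Density of the discs -/

open Filter Topology in
theorem exists_seq_tendsto_one_add_four_mul_div (z : ℂ) :
    ∃ y : ℕ → ℂ, Tendsto y atTop (𝓝 z) ∧
      ∀ i, ∃ m : ℕ, Odd m ∧ ∃ ξ ∈ OF, y i = (1 + 4 * ξ) / (2 * m) := by
  let m : ℕ → ℕ := fun i => 2 * i + 1
  have hm0 : ∀ i, (m i : ℂ) ≠ 0 := fun i => by exact_mod_cast (Nat.succ_ne_zero (2 * i))
  -- Rounding to `ℤ[ρ]` costs a bounded error, which is divided by `2 m → ∞`.
  choose ξ hξ hξ' using fun i => exists_mem_OF_norm_sub_le ((2 * m i * z - 1) / 4)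
  refine ⟨fun i => (1 + 4 * ξ i) / (2 * m i), ?_, fun i => ⟨m i, ⟨i, rfl⟩, ξ i, hξ i, rfl⟩⟩
  rw [tendsto_iff_norm_sub_tendsto_zero]
  have hlim : Tendsto (fun i : ℕ => 2 * (1 / ((i : ℝ) + 1))) atTop (𝓝 0) := by
    simpa using (tendsto_one_div_add_atTop_nhds_zero_nat (𝕜 := ℝ)).const_mul 2
  refine squeeze_zero (fun _ => norm_nonneg _) (fun i => ?_) hlim
  have e : (1 + 4 * ξ i) / (2 * m i) - z
      = -(4 / (2 * m i)) * ((2 * m i * z - 1) / 4 - ξ i) := by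
    have := hm0 i
    field_simp
    ring
  have hmi : ((i : ℝ) + 1) ≤ m i := by
    simp only [m]
    push_cast
    have : (0 : ℝ) ≤ i := by positivity
    linarith
  have hi : (0 : ℝ) < (i : ℝ) + 1 := by positivity
  rw [e, norm_mul, norm_neg, norm_div, norm_mul, Complex.norm_natCast, Complex.norm_ofNat,
    Complex.norm_ofNat]
  calc (4 / (2 * m i) : ℝ) * _ ≤ 4 / (2 * m i) * 1 := by gcongr; exact hξ' i
    _ = 2 * (1 / m i) := by
        have : (m i : ℝ) ≠ 0 := by linarith
        field_simp
        ring
    _ ≤ _ := by gcongr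

/-- The vector `n = (1 + 4 ξ, m r, 2 m)` with `m`, `r` odd satisfies `h(n) ≡ 2 mod 4`, so that
modular forms vanish on the disc `n^⊥` in the direction of `n`. -/
theorem homogForm_eq_zero_of_odd {f : ball → SymPow j}
    (hf : f ∈ modularForms j k Gam1SqrtNeg3) (hk : k < 0) {r m : ℕ} (hr : Odd r) (hm : Odd m)
    {ξ : ℂ} (hξ : ξ ∈ OF) (hre : 0 < (1 + 4 * ξ).re) {X : Fin 3 → ℂ}
    (hX : (hermForm X).re < 0) (horth : herm X ![1 + 4 * ξ, m * r, 2 * m] = 0) :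
    homogForm k f X ![1 + 4 * ξ, m * r, 2 * m] = 0 := by
  obtain ⟨a, b, rfl⟩ := mem_OF_iff.mp hξ
  have hn : ∀ l, (![1 + 4 * (a + b * rho), m * r, 2 * m] : Fin 3 → ℂ) l ∈ OF := by
    intro l
    fin_cases l
    · exact add_mem (one_mem _) (mul_mem (ofNat_mem _ 4) hξ)
    · exact mul_mem (natCast_mem _ _) (natCast_mem _ _)
    · exact mul_mem (ofNat_mem _ 2) (natCast_mem _ _)
  have hpos : (0 : ℤ) < 1 + 4 * a - 2 * b := by
    have : (1 + 4 * (a + b * rho) : ℂ).re = 1 + 4 * a - 2 * b := by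
      simp [rho_re]
      ring
    rw [this] at hre
    exact_mod_cast hre
  refine homogForm_eq_zero_of_orthogonal hf hk hn (T := m * r * (2 + 4 * (2 * a - b)))
    (c := m * r * (2 + 4 * (2 * a - b)) + 4 * m ^ 2) ?_ ?_ ?_ ?_ hX horth
  · simp only [cons_val_zero, cons_val_one, map_add, map_mul, map_one, map_natCast, map_ofNat,
      map_intCast, conj_rho]
    push_cast
    ring
  · simp only [cons_val, map_mul, map_natCast, map_ofNat]
    push_cast
    ring
  · have h1 : (0 : ℤ) < m := by exact_mod_cast hm.pos
    have h2 : (0 : ℤ) < r := by exact_mod_cast hr.pos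
    have h3 : (0 : ℤ) < 2 + 4 * (2 * a - b) := by linarith
    positivity
  · obtain ⟨r', rfl⟩ := hr
    obtain ⟨m', rfl⟩ := hm
    have : (((2 * m' + 1 : ℕ) : ℤ) * ((2 * r' + 1 : ℕ) : ℤ) * (2 + 4 * (2 * a - b))
          + 4 * ((2 * m' + 1 : ℕ) : ℤ) ^ 2)
        = 2 + 4 * ((2 * m' + 1) * (2 * r' + 1) * (2 * a - b) + (2 * m' + 1) ^ 2
          + (2 * m' * r' + m' + r')) := by
      push_cast
      ring
    rw [this]
    omega

open Filter Topology in
/-- The directions of the discs of `homogForm_eq_zero_of_odd`, suitably normalised, approximate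
`Q = (-q v̄ - ū, q, 1)` with `q = r / 2`, which is orthogonal to `(v, 1, u)`. -/
theorem eval_eq_zero_of_odd {f : ball → SymPow j} (hf : f ∈ modularForms j k Gam1SqrtNeg3)
    (hk : k < 0) {u v : ℂ} (hp : (u, v) ∈ ball) {r : ℕ} (hr : Odd r)
    (hpos : u.re + r / 2 * v.re < 0) :
    MvPolynomial.eval ![1 - u * (r / 2), -conj u - (v + conj v) * (r / 2)]
      (f ⟨(u, v), hp⟩).1 = 0 := by
  have hrC : (r : ℂ) ≠ 0 := by exact_mod_cast hr.pos.ne'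
  obtain ⟨z, hz⟩ : ∃ z : ℂ, z = -(r / 2) * conj v - conj u := ⟨_, rfl⟩
  have hzre : 0 < z.re := by
    have : z.re = -(r / 2) * v.re - u.re := by
      rw [hz]
      simp
    rw [this]
    linarith
  obtain ⟨y, hy, hyξ⟩ := exists_seq_tendsto_one_add_four_mul_div z
  let Xs : ℂ → Fin 3 → ℂ := fun x => ![-(conj x + u) / (r / 2), 1, u]
  let Qs : ℂ → Fin 3 → ℂ := fun x => ![x, r / 2, 1]
  have hXs : Continuous Xs := by
    refine continuous_pi fun i => ?_
    fin_cases i <;> simp [Xs] <;> fun_prop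
  have hQs : Continuous Qs := by
    refine continuous_pi fun i => ?_
    fin_cases i <;> simp [Qs] <;> fun_prop
  have hXz : Xs z = ![v, 1, u] := by
    have : -(conj z + u) / (r / 2) = v := by
      rw [hz]
      simp only [map_sub, map_mul, map_neg, map_div₀, Complex.conj_conj, map_natCast, map_ofNat]
      field_simp
      ring
    simp only [Xs, this]
  have hopen : IsOpen {X : Fin 3 → ℂ | (hermForm X).re < 0} := by
    simp only [hermForm]
    exact isOpen_lt (by fun_prop) continuous_const
  have hXzneg : (hermForm (Xs z)).re < 0 := by
    rw [hXz, hermForm_lift (u, v), Complex.ofReal_re]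
    exact hp
  have hzero : ∀ᶠ i in atTop, homogForm k f (Xs (y i)) (Qs (y i)) = 0 := by
    have hev1 : ∀ᶠ x in 𝓝 z, 0 < x.re :=
      (isOpen_lt continuous_const Complex.continuous_re).mem_nhds hzre
    have hev2 : ∀ᶠ x in 𝓝 z, (hermForm (Xs x)).re < 0 := (hopen.preimage hXs).mem_nhds hXzneg
    filter_upwards [hy.eventually hev1, hy.eventually hev2] with i hi hXi
    obtain ⟨m, hm, ξ, hξ, hyi⟩ := hyξ i
    have hmC : (m : ℂ) ≠ 0 := by exact_mod_cast hm.pos.ne'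
    have hmy : 1 + 4 * ξ = 2 * m * y i := by
      rw [hyi]
      field_simp
    have hnQ : ![1 + 4 * ξ, m * r, 2 * m] = (2 * m : ℂ) • Qs (y i) := by
      rw [hmy]
      funext l
      fin_cases l
      · simp [Qs]
      · simp [Qs]
        field_simp
      · simp [Qs]
    have hre : 0 < (1 + 4 * ξ).re := by
      have h : (1 + 4 * ξ : ℂ) = ((2 * m : ℝ) : ℂ) * y i := by
        rw [hmy]
        push_cast
        ring
      have hmR : (0 : ℝ) < m := by exact_mod_cast hm.pos
      rw [h, Complex.re_ofReal_mul]
      positivity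
    have horth : herm (Xs (y i)) ![1 + 4 * ξ, m * r, 2 * m] = 0 := by
      rw [hnQ]
      simp only [herm, Xs, Qs, Pi.smul_apply, smul_eq_mul, cons_val_zero, cons_val_one, cons_val,
        map_mul, map_div₀, map_natCast, map_ofNat, map_one]
      field_simp
      ring
    have h := homogForm_eq_zero_of_odd hf hk hr hm hξ hre hXi horth
    rw [hnQ, homogForm_smul_right] at h
    exact (mul_eq_zero.mp h).resolve_left (pow_ne_zero _ (mul_ne_zero two_ne_zero hmC))
  have hcont : ContinuousAt (fun x => homogForm k f (Xs x) (Qs x)) z :=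
    ContinuousAt.comp (g := fun Z : (Fin 3 → ℂ) × (Fin 3 → ℂ) => homogForm k f Z.1 Z.2)
      (f := fun x => (Xs x, Qs x)) (differentiableAt_homogForm hf.1 hXzneg).continuousAt
      (hXs.prodMk hQs).continuousAt
  have hlim : homogForm k f (Xs z) (Qs z) = 0 :=
    tendsto_nhds_unique (hcont.tendsto.comp hy)
      (tendsto_const_nhds.congr' (hzero.mono fun i hi => hi.symm))
  rw [hXz, homogForm_eq_eval f (p := ⟨(u, v), hp⟩) (by simp)] at hlim
  simp only [cons_val_one, cons_val_zero, _root_.one_zpow, one_mul, Qs, cons_val, hz] at hlim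
  rw [← hlim]
  congr 2
  funext l
  fin_cases l
  · simp
  · simp
    ring

/-! ### Vanishing of polynomials -/

/-- A binary form that vanishes at infinitely many points of an affine line not through the origin
is zero. -/
theorem eq_zero_of_infinite_line {P : MvPolynomial (Fin 2) ℂ} (hP : P.IsHomogeneous j)
    {a b d e : ℂ} (hdet : a * e - b * d ≠ 0) {S : Set ℂ} (hS : S.Infinite)
    (h : ∀ q ∈ S, MvPolynomial.eval ![a + d * q, b + e * q] P = 0) : P = 0 := by
  have hall : ∀ q : ℂ, MvPolynomial.eval ![a + d * q, b + e * q] P = 0 := by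
    let g : Polynomial ℂ := MvPolynomial.aeval ![Polynomial.C a + Polynomial.C d * Polynomial.X,
      Polynomial.C b + Polynomial.C e * Polynomial.X] P
    have hg : ∀ q, g.eval q = MvPolynomial.eval ![a + d * q, b + e * q] P := by
      intro q
      have : (Polynomial.aeval q).comp (MvPolynomial.aeval
          ![Polynomial.C a + Polynomial.C d * Polynomial.X,
            Polynomial.C b + Polynomial.C e * Polynomial.X])
          = MvPolynomial.aeval (R := ℂ) ![a + d * q, b + e * q] := by
        ext i
        fin_cases i <;> simp
      have h' := DFunLike.congr_fun this P
      simpa [g, MvPolynomial.aeval_eq_eval, Polynomial.coe_aeval_eq_eval] using h'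
    have hg0 : g = 0 := Polynomial.eq_zero_of_infinite_isRoot g
      (hS.mono fun q hq => by
        change g.eval q = 0
        rw [hg, h q hq])
    intro q
    rw [← hg, hg0, Polynomial.eval_zero]
  -- Off the line `e x₀ = d x₁` every point is a multiple of a point of the given line.
  let l : MvPolynomial (Fin 2) ℂ :=
    MvPolynomial.C e * MvPolynomial.X 0 - MvPolynomial.C d * MvPolynomial.X 1
  have hl : l * P = 0 := by
    refine MvPolynomial.funext fun x => ?_
    rw [map_mul, map_zero]
    have hlx : MvPolynomial.eval x l = e * x 0 - d * x 1 := by simp [l]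
    by_cases hx : e * x 0 - d * x 1 = 0
    · rw [hlx, hx, zero_mul]
    · have hxe : x = ((e * x 0 - d * x 1) / (a * e - b * d)) •
          ![a + d * ((a * x 1 - b * x 0) / (e * x 0 - d * x 1)),
            b + e * ((a * x 1 - b * x 0) / (e * x 0 - d * x 1))] := by
        obtain ⟨L, hL⟩ : ∃ L, L = e * x 0 - d * x 1 := ⟨_, rfl⟩
        obtain ⟨D, hD⟩ : ∃ D, D = a * e - b * d := ⟨_, rfl⟩
        rw [← hL, ← hD]
        rw [← hL] at hx
        rw [← hD] at hdet
        funext i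
        fin_cases i
        · simp
          field_simp
          rw [hL, hD]
          ring
        · simp
          field_simp
          rw [hL, hD]
          ring
      rw [hxe, eval_smul_of_isHomogeneous hP, hall, mul_zero, mul_zero]
  refine (mul_eq_zero.mp hl).resolve_left fun hl0 => hdet ?_
  have h1 : MvPolynomial.eval ![a, b] l = 0 := by rw [hl0, map_zero]
  simp [l] at h1
  linear_combination h1

end Picard

theorem mainTheorem12 (j : ℕ) (k : ℤ) (hk : k < 0) :
    Picard.modularForms j k Picard.Gam1SqrtNeg3 = ⊥ := by
  rw [Submodule.eq_bot_iff]
  intro f hf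
  funext ⟨⟨u, v⟩, hp⟩
  have hball : 2 * v.re + ‖u‖ ^ 2 < 0 := hp
  have hv : v.re < 0 := by nlinarith [sq_nonneg ‖u‖]
  -- For `r > r₀` the direction `Q` attached to `r` satisfies `Re (Q₀ Q̄₁) > 0`.
  obtain ⟨r₀, hr₀⟩ := exists_nat_gt (2 * u.re / (-v.re))
  refine Subtype.ext (Picard.eq_zero_of_infinite_line (f _).2 (a := 1) (b := -conj u)
    (d := -u) (e := -(v + conj v))
    (S := Set.range fun i : ℕ => (((2 * (i + r₀) + 1 : ℕ) : ℂ) / 2)) ?_ ?_ ?_)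
  · -- This determinant is `-(2 Re v + |u|²)`.
    have h : 1 * (-(v + conj v)) - -conj u * -u
        = ((-(2 * v.re + ‖u‖ ^ 2) : ℝ) : ℂ) := by
      rw [Complex.add_conj]
      push_cast
      rw [← Complex.conj_mul']
      ring
    rw [h]
    exact_mod_cast (neg_pos.mpr hball).ne'
  · refine Set.infinite_range_of_injective fun i i' h => ?_
    have h' : ((2 * (i + r₀) + 1 : ℕ) : ℂ) = ((2 * (i' + r₀) + 1 : ℕ) : ℂ) := by
      simpa using h
    have := Nat.cast_injective h'
    omega
  · rintro _ ⟨i, rfl⟩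
    have h := Picard.eval_eq_zero_of_odd hf hk hp (r := 2 * (i + r₀) + 1) ⟨_, rfl⟩ ?_
    · rw [← h]
      congr 2
      funext l
      fin_cases l
      · simp
        ring
      · simp
        ring
    · rw [div_lt_iff₀ (by linarith)] at hr₀
      push_cast
      have : (0 : ℝ) ≤ i := by positivity
      nlinarith
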